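/- **Theorem 7.3.** Let $d\ge 1$ be an integer, $\mathbb T^d=(\mathbb R/2\pi\mathbb Z)^d$, $\hat f(k)=(2\pi)^{-d}\int_{\mathbb T^d}f(x)e^{-ik\cdot x}\,dx$ for $k\in\mathbb Z^d$, and let $|k|$ be the Euclidean length of $k$. For $r,\beta>0$ and mean-free $f$ (that is, $\hat f(0)=0$) define the Gevrey norm $$\|f\|_\beta=\|A^{r/2}e^{\beta A^{1/2}}f\|_{L^2}=\Big((2\pi)^d\sum_{k\in\mathbb Z^d}|k|^{2r}e^{2\beta|k|}|\hat f(k)|^2\Big)^{1/2},\qquad A=-\Delta .$$ Let $F(z)=\sum_{n\ge1}a_nz^n$ with real coefficients $a_n$ and $$R_M=\sup\Big\{s\ge 0:\ \sum_{n\ge1}|a_n|s^n<\infty\Big\}>0 ,$$ and for $s\ge 0$ put $$\widetilde F(s)=\sum_{n=1}^\infty |a_n|\,n^{r+\frac32}\,C_W^{\,n-1}s^{n-1}\in[0,\infty],\qquad C_W=\Big((2\pi)^{-d}\sum_{k\in\mathbb Z^d\setminus\{0\}}|k|^{-(2r-1)}\Big)^{1/2};$$ here $C_W$ is the best constant in the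 inequality $\sum_k|\hat v(k)|\le C_W\|A^{(r-\frac12)/2}v\|_{L^2}$ for mean-free $v$. Let $T$ be the Fourier multiplier $\widehat{Tf}(k)=m_T(k)\hat f(k)$, where $m_T:\mathbb Z^d\to\mathbb C$ satisfies $m_T(0)=0$ and $|m_T(k)|\le C_T|k|$ for $k\ne0$. For every $d\ge1$ and $C_T>0$ there is a constant $C>0$, depending on $d$ and $C_T$ only, such that the following holds for all $r>\frac{d+1}2$, all $F$ and $m_T$ as above, all $\beta_0>0$ and all mean-free $u_0\in L^2(\mathbb T^d;\mathbb C)$ with $\|u_0\|_{\beta_0}<\infty$. On the punctured disc $$\mathcal R=\Big\{\zeta\in\mathbb C:\ 0<|\zeta|<\frac{C\beta_0}{\widetilde F(\|u_0\|_{\beta_0})}\Big\}$$ (empty if $\widetilde F(\|u_0\|_{\beta_0})=\infty$, and equal to $\mathbb C\setminus\{0\}$ if $\widetilde F(\|u_0\|_{\beta_0})=0$) the complexified problem $$\frac{du}{d\zeta}=T\,F(u),\qquad u(0)=u_0,$$ has exactly one solution. Here a solution is a map $u$ from $\mathcal R\cup\{0\}$ to the continuous complex-valued functions on $\mathbb T^d$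 with the supremum norm which is complex differentiable on $\mathcal R$ and continuous at $0$, with $u(0)=u_0$ almost everywhere, and such that for all $\zeta\in\mathcal R$ the function $u(\zeta)$ is mean-free, $|u(\zeta,x)|<R_M$ for all $x$, and the equation holds. Moreover, the solution is holomorphic with values in Gevrey classes: every $\zeta_0\in\mathcal R$ has a neighbourhood and a $\beta>0$ such that on this neighbourhood $\|u(\zeta)\|_\beta<\infty$ and $u$ is complex differentiable in the norm $\|\cdot\|_\beta$. -/

import Mathlib

open MeasureTheory Filter Topology Set
open scoped ENNReal NNReal

noncomputable section

namespace GevreyAnalytic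

instance fact_two_pi_pos : Fact (0 < 2 * Real.pi) := ⟨Real.two_pi_pos⟩

/-- The spatial domain: the torus `(ℝ / 2πℤ)^d`. Its `volume` is Lebesgue measure on `[0, 2π]^d`,
of total mass `(2π)^d`. -/
abbrev Torus (d : ℕ) : Type := Fin d → AddCircle (2 * Real.pi)

/-- The Euclidean length `|k|` of a frequency `k ∈ ℤ^d`. -/
def freqNorm {d : ℕ} (k : Fin d → ℤ) : ℝ := Real.sqrt (∑ i, (k i : ℝ) ^ 2)

/-- The character `x ↦ exp(-i k·x)`; on the circle of length `2π`, `fourier n` is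
`x ↦ exp(i n x)`. -/
def conjChar {d : ℕ} (k : Fin d → ℤ) (x : Torus d) : ℂ := ∏ i, fourier (-k i) (x i)

/-- The Fourier coefficient `(2π)^{-d} ∫ f(x) exp(-i k·x) dx`. -/
def coeff {d : ℕ} (f : Torus d → ℂ) (k : Fin d → ℤ) : ℂ :=
  ((2 * Real.pi : ℂ) ^ d)⁻¹ * ∫ x : Torus d, f x * conjChar k x

/-- The Gevrey norm `‖A^{r/2} exp(β A^{1/2}) f‖_{L²}` with `A = -Δ`, that is
`((2π)^d ∑_k |k|^{2r} exp(2β|k|) |f̂(k)|²)^{1/2}`, as an extended nonnegative number. -/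
def gevreyNorm {d : ℕ} (r β : ℝ) (f : Torus d → ℂ) : ℝ≥0∞ :=
  (ENNReal.ofReal ((2 * Real.pi) ^ d) *
    ∑' k : Fin d → ℤ,
      ENNReal.ofReal (freqNorm k ^ (2 * r) * Real.exp (2 * β * freqNorm k) * ‖coeff f k‖ ^ 2))
    ^ (1 / 2 : ℝ)

/-- The constant of the embedding of the mean-free Sobolev space of order `r - 1/2` in the Wiener
algebra, `∑_k |v̂(k)| ≤ C_W ‖A^{(r-1/2)/2} v‖_{L²}`; its best value is
`C_W = ((2π)^{-d} ∑_{k ≠ 0} |k|^{-(2r-1)})^{1/2}`. -/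
def wienerConst (d : ℕ) (r : ℝ) : ℝ≥0∞ :=
  (ENNReal.ofReal (((2 * Real.pi) ^ d)⁻¹) *
    ∑' k : {k : Fin d → ℤ // k ≠ 0}, ENNReal.ofReal (freqNorm k.1 ^ (-(2 * r - 1))))
    ^ (1 / 2 : ℝ)

/-- The series `F(z) = ∑ a_n z^n` with real coefficients, at complex arguments. -/
def powerFun (a : ℕ → ℝ) (z : ℂ) : ℂ := ∑' n : ℕ, (a n : ℂ) * z ^ n

/-- `R_M = sup {s ≥ 0 : ∑ |a_n| s^n < ∞}`. -/
def majorantRadius (a : ℕ → ℝ) : ℝ≥0∞ :=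
  ⨆ s ∈ {s : ℝ≥0 | ∑' n : ℕ, ‖a n‖ₑ * (s : ℝ≥0∞) ^ n < ∞}, (s : ℝ≥0∞)

/-- `F̃(s) = ∑_{n ≥ 1} |a_n| n^{r+3/2} C_W^{n-1} s^{n-1}`, with value `∞` where the series
diverges (the summation index is `n - 1`). -/
def Ftilde (d : ℕ) (r : ℝ) (a : ℕ → ℝ) (s : ℝ≥0∞) : ℝ≥0∞ :=
  ∑' n : ℕ, ‖a (n + 1)‖ₑ * ENNReal.ofReal (((n : ℝ) + 1) ^ (r + 3 / 2)) *
    wienerConst d r ^ n * s ^ n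

/-- The punctured disc `0 < |ζ| < C β₀ / F̃(s)`. The quotient is computed in `[0, ∞]`, so the disc
is empty if `F̃(s) = ∞`, and is `ℂ \ {0}` if `F̃(s) = 0`. -/
def region (d : ℕ) (r : ℝ) (a : ℕ → ℝ) (C β₀ : ℝ) (s : ℝ≥0∞) : Set ℂ :=
  {ζ | ζ ≠ 0 ∧ ‖ζ‖ₑ < ENNReal.ofReal (C * β₀) / Ftilde d r a s}

/-- `g = T f`, where `T` is the Fourier multiplier with symbol `m`. -/
def IsMultiplierImage {d : ℕ} (m : (Fin d → ℤ) → ℂ) (f g : Torus d → ℂ) : Prop :=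
  ∀ k, coeff g k = m k * coeff f k

/-- `u` is a solution on `R` of the complexified problem `du/dζ = T F(u)`, `u(0) = u₀`:
it takes mean-free values on which `F` is defined (by its power series), is complex differentiable
on `R`, satisfies the equation there, and is continuous at `0`, with value `u₀`. -/
structure IsSolution {d : ℕ} (m : (Fin d → ℤ) → ℂ) (a : ℕ → ℝ) (u₀ : Torus d → ℂ)
    (R : Set ℂ) (u : ℂ → C(Torus d, ℂ)) : Prop where
  mean_free : ∀ ζ ∈ R, coeff (u ζ) 0 = 0
  mem_domain : ∀ ζ ∈ R, ∀ x, ‖u ζ x‖ₑ < majorantRadius a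
  equation : ∀ ζ ∈ R, ∃ w : C(Torus d, ℂ),
    HasDerivAt u w ζ ∧ IsMultiplierImage m (fun x => powerFun a (u ζ x)) w
  initial : (u 0 : Torus d → ℂ) =ᵐ[volume] u₀
  continuous_zero : ContinuousWithinAt u R 0

/-- `u` is holomorphic on `R` with values in Gevrey classes: near each point of `R` there is one
`β > 0` such that `u` takes values of finite Gevrey norm of radius `β` and is complex
differentiable in that norm. -/
def GevreyHolomorphicOn {d : ℕ} (r : ℝ) (R : Set ℂ) (u : ℂ → C(Torus d, ℂ)) : Prop :=
  ∀ ζ₀ ∈ R, ∃ β : ℝ, 0 < β ∧ ∀ᶠ ζ in 𝓝 ζ₀, gevreyNorm r β (u ζ) < ∞ ∧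
    Tendsto (fun h : ℂ => gevreyNorm r β (h⁻¹ • (u (ζ + h) - u ζ) - deriv u ζ : C(Torus d, ℂ)))
      (𝓝[≠] 0) (𝓝 0)

end GevreyAnalytic

end

/-! Write the problem as `u(ζ) = u₀ + T ∫₀^ζ F(u)` and follow the Fourier coefficients of the Picard
iterates, started from zero, with an exponential weight whose radius shrinks with `|ζ|`. Put `β₀ =
2b` and `G(k) = exp(2b|k|)|û₀(k)|`. On the disc `|ζ| < b/lam` the aim is `exp((b - lam|ζ|)|k|)
|û_j(ζ,k)| ≤ V_j(k)`, with `V_j` independent of `ζ`. Integrating `exp(-(b - lam t)|k|)` along a ray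
yields a factor `1/(lam|k|)`, which pays for the derivative lost in `T`, and leaves a factor at most
`1 - exp(-b|k|)` (`expWeight_mul_multiplier_primitive_le`). So one may take `V_{j+1} = exp(-b|k|) G
+ (1 - exp(-b|k|)) ε ∑ |a_n| V_j^{*n}`, with `ε = CT/lam`.

The point is that the Sobolev norm of order `r` does not grow under this recursion
(`majorantIter_bounds`). Each step is a convex combination, so by convexity of the square the
nonlinear term enters only through the weight `|k|^r (1 - exp(-b|k|))^{1/2}`. In a convolution of
`n` factors this weight can be moved onto a factor whose frequency is at least `|k|/n`, at cost
`n^r` from the power and `n^{1/2}` from Bernoulli's inequality; the choice of that factor costs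
another `n`. The remaining factors are summed by the Wiener embedding. This produces `n^{r+3/2}`,
hence `F̃`, and `2 ε F̃ ≤ 1` suffices to close the induction; it determines `lam` and thereby the
radius of the disc.

No contraction is needed. The `V_j` increase, and consecutive iterates satisfy "weighted difference
plus `V_j` is at most `V_{j+1}`" (`picardIter_succ_sub_le`); thus convergence of the `V_j` forces
convergence of the iterates. The limit is holomorphic coefficient by coefficient, and the bound by
its majorant upgrades this to holomorphy in the supremum norm and in Gevrey norms.

For uniqueness, `T` is unbounded on continuous functions, so a Gronwall argument is unavailable.
Solutions are, however, analytic across `0` by removability of the singularity. If their difference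
were `z^{p+1} g(z)` with `g(0) ≠ 0`, comparing lowest orders in each single Fourier coefficient,
where `T` acts as a bounded factor, would give `g(0) = 0` (`eventually_eq_zero_of_coeff_deriv_le`).
The identity theorem does the rest. -/

noncomputable section

namespace GevreyAnalytic

/-! ### Convolution of nonnegative families -/

section Convolution

variable {K : Type*} [AddCommGroup K]

/-- The convolution of two nonnegative families indexed by an additive group. -/
def conv (A B : K → ℝ≥0∞) (k : K) : ℝ≥0∞ := ∑' l, A l * B (k - l)

open Classical in
/-- Convolution powers of a nonnegative family. -/
def convPow (V : K → ℝ≥0∞) : ℕ → K → ℝ≥0∞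
  | 0 => Pi.single 0 1
  | n + 1 => conv V (convPow V n)

/-- The linearisation of the `n`-th convolution power at `V`, in the direction `B`. -/
def convLin (V B : K → ℝ≥0∞) : ℕ → K → ℝ≥0∞
  | 0 => 0
  | n + 1 => conv B (convPow V n) + conv V (convLin V B n)

lemma conv_mono {A A' B B' : K → ℝ≥0∞} (hA : A ≤ A') (hB : B ≤ B') : conv A B ≤ conv A' B' :=
  fun _ => ENNReal.tsum_le_tsum fun _ => mul_le_mul' (hA _) (hB _)

lemma conv_comm (A B : K → ℝ≥0∞) : conv A B = conv B A := by
  ext k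
  unfold conv
  rw [← (Equiv.subLeft k).tsum_eq]
  simp [mul_comm]

lemma conv_add (A B B' : K → ℝ≥0∞) : conv A (B + B') = conv A B + conv A B' := by
  ext k
  simp [conv, mul_add, ENNReal.tsum_add]

lemma add_conv (A A' B : K → ℝ≥0∞) : conv (A + A') B = conv A B + conv A' B := by
  ext k
  simp [conv, add_mul, ENNReal.tsum_add]

lemma conv_smul (c : ℝ≥0∞) (A B : K → ℝ≥0∞) : conv A (c • B) = c • conv A B := by
  ext k
  simp only [conv, Pi.smul_apply, smul_eq_mul, ← ENNReal.tsum_mul_left]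
  exact tsum_congr fun l => by ring

lemma smul_conv (c : ℝ≥0∞) (A B : K → ℝ≥0∞) : conv (c • A) B = c • conv A B := by
  rw [conv_comm, conv_smul, conv_comm]

lemma tsum_translate (B : K → ℝ≥0∞) (l : K) : ∑' k, B (k - l) = ∑' k, B k :=
  (Equiv.subRight l).tsum_eq B

lemma tsum_conv (A B : K → ℝ≥0∞) : ∑' k, conv A B k = (∑' k, A k) * ∑' k, B k := by
  unfold conv
  rw [ENNReal.tsum_comm, ← ENNReal.tsum_mul_right]
  exact tsum_congr fun l => by rw [ENNReal.tsum_mul_left, tsum_translate]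

lemma tsum_convPow (V : K → ℝ≥0∞) (n : ℕ) : ∑' k, convPow V n k = (∑' k, V k) ^ n := by
  induction n with
  | zero => simp [convPow]
  | succ n ih => rw [convPow, tsum_conv, ih, pow_succ']

lemma convPow_mono {V V' : K → ℝ≥0∞} (h : V ≤ V') (n : ℕ) : convPow V n ≤ convPow V' n := by
  induction n with
  | zero => exact le_rfl
  | succ n ih => exact conv_mono h ih

lemma convLin_mono {V B B' : K → ℝ≥0∞} (h : B ≤ B') (n : ℕ) : convLin V B n ≤ convLin V B' n := by
  induction n with
  | zero => exact le_rfl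
  | succ n ih => exact add_le_add (conv_mono h le_rfl) (conv_mono le_rfl ih)

lemma convLin_smul (c : ℝ≥0∞) (V B : K → ℝ≥0∞) (n : ℕ) :
    convLin V (c • B) n = c • convLin V B n := by
  induction n with
  | zero => simp [convLin]
  | succ n ih => simp only [convLin, ih, conv_smul, smul_conv, smul_add]

/-- Expanding the power, a word in `A` and `B` either consists of `A` only or contains a `B`. The
words of the second kind are overcounted by choosing a position of a `B` and letting every other
factor be `A + B`. -/
lemma convPow_add_le (A B : K → ℝ≥0∞) (n : ℕ) :
    convPow (A + B) n ≤ convPow A n + convLin (A + B) B n := by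
  induction n with
  | zero => simp [convPow, convLin]
  | succ n ih =>
    simp only [convPow, convLin]
    calc conv (A + B) (convPow (A + B) n)
        = conv A (convPow (A + B) n) + conv B (convPow (A + B) n) := add_conv _ _ _
      _ ≤ (conv A (convPow A n) + conv (A + B) (convLin (A + B) B n))
          + conv B (convPow (A + B) n) := by
          gcongr
          refine (conv_mono le_rfl ih).trans ?_
          rw [conv_add]
          gcongr
          exact conv_mono (le_add_of_nonneg_right zero_le) le_rfl
      _ = _ := by rw [add_assoc, add_comm (conv (A + B) _)]

lemma exists_of_conv_ne_zero {A B : K → ℝ≥0∞} {k : K} (h : conv A B k ≠ 0) :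
    ∃ l, A l ≠ 0 ∧ B (k - l) ≠ 0 := by
  by_contra! hc
  refine h (ENNReal.tsum_eq_zero.2 fun l => ?_)
  by_cases hl : A l = 0
  · simp [hl]
  · simp [hc l hl]

end Convolution

/-! ### Square sums: Minkowski and Young inequalities -/

section SquareSum

variable {K ι : Type*}

/-- The `ℓ²` norm of a nonnegative family. -/
def l2 (X : K → ℝ≥0∞) : ℝ≥0∞ := (∑' k, X k ^ 2) ^ (1 / 2 : ℝ)

lemma l2_sq (X : K → ℝ≥0∞) : l2 X ^ 2 = ∑' k, X k ^ 2 := by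
  rw [l2, ← ENNReal.rpow_natCast, ← ENNReal.rpow_mul]
  norm_num

lemma l2_le_iff {X : K → ℝ≥0∞} {c : ℝ≥0∞} : l2 X ≤ c ↔ ∑' k, X k ^ 2 ≤ c ^ 2 := by
  rw [← l2_sq]
  exact (ENNReal.pow_le_pow_left_iff two_ne_zero).symm

lemma l2_mono {X Y : K → ℝ≥0∞} (h : X ≤ Y) : l2 X ≤ l2 Y := by
  unfold l2
  gcongr with k
  exact h k

lemma l2_smul (c : ℝ≥0∞) (X : K → ℝ≥0∞) : l2 (c • X) = c * l2 X := by
  simp only [l2, Pi.smul_apply, smul_eq_mul, mul_pow, ENNReal.tsum_mul_left]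
  rw [ENNReal.mul_rpow_of_nonneg _ _ (by norm_num), ← ENNReal.rpow_natCast, ← ENNReal.rpow_mul]
  norm_num

lemma l2_translate [AddCommGroup K] (X : K → ℝ≥0∞) (l : K) : l2 (fun k => X (k - l)) = l2 X := by
  unfold l2
  rw [tsum_translate (fun k => X k ^ 2)]

lemma tsum_mul_le_l2 (X Y : K → ℝ≥0∞) : ∑' k, X k * Y k ≤ l2 X * l2 Y := by
  refine ENNReal.summable.tsum_le_of_sum_le fun s => ?_
  refine (ENNReal.inner_le_Lp_mul_Lq s X Y Real.HolderConjugate.two_two).trans ?_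
  simp only [ENNReal.rpow_two]
  gcongr <;> exact ENNReal.rpow_le_rpow (ENNReal.sum_le_tsum s) (by norm_num)

lemma l2_add_le (X Y : K → ℝ≥0∞) : l2 (X + Y) ≤ l2 X + l2 Y := by
  rw [l2_le_iff]
  refine ENNReal.summable.tsum_le_of_sum_le fun s => ?_
  have h := ENNReal.Lp_add_le s X Y (p := 2) (by norm_num)
  simp only [ENNReal.rpow_two] at h
  have h2 : (∑ i ∈ s, (X i + Y i) ^ 2) ^ (1 / 2 : ℝ) ≤ l2 X + l2 Y := by
    refine h.trans ?_
    gcongr <;> exact ENNReal.rpow_le_rpow (ENNReal.sum_le_tsum s) (by norm_num)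
  have h3 := pow_le_pow_left' h2 2
  rwa [← ENNReal.rpow_natCast, ← ENNReal.rpow_mul, Nat.cast_two, one_div,
    inv_mul_cancel₀ two_ne_zero, ENNReal.rpow_one] at h3

lemma l2_sum_le (s : Finset ι) (X : ι → K → ℝ≥0∞) :
    l2 (fun k => ∑ i ∈ s, X i k) ≤ ∑ i ∈ s, l2 (X i) := by
  classical
  induction s using Finset.induction_on with
  | empty => simp [l2]
  | insert i s hi ih =>
    simp only [Finset.sum_insert hi]
    exact (l2_add_le (X i) _).trans (by gcongr)

/-- Minkowski's inequality for infinite sums. -/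
lemma l2_tsum_le (X : ι → K → ℝ≥0∞) : l2 (fun k => ∑' i, X i k) ≤ ∑' i, l2 (X i) := by
  rw [l2_le_iff]
  refine ENNReal.summable.tsum_le_of_sum_le fun s => ?_
  have h : Tendsto (fun t : Finset ι => ∑ k ∈ s, (∑ i ∈ t, X i k) ^ 2) atTop
      (𝓝 (∑ k ∈ s, (∑' i, X i k) ^ 2)) :=
    tendsto_finsetSum _ fun k _ => ENNReal.Tendsto.pow ENNReal.summable.hasSum
  refine le_of_tendsto' h fun t => ?_
  calc ∑ k ∈ s, (∑ i ∈ t, X i k) ^ 2 ≤ ∑' k, (∑ i ∈ t, X i k) ^ 2 := ENNReal.sum_le_tsum s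
    _ ≤ (∑' i, l2 (X i)) ^ 2 := by
      rw [← l2_le_iff]
      exact (l2_sum_le t X).trans (ENNReal.sum_le_tsum t)

/-- Young's inequality. -/
lemma l2_conv_le [AddCommGroup K] (A X : K → ℝ≥0∞) : l2 (conv A X) ≤ (∑' k, A k) * l2 X := by
  refine (l2_tsum_le fun l k => A l * X (k - l)).trans ?_
  rw [← ENNReal.tsum_mul_right]
  refine ENNReal.tsum_le_tsum fun l => ?_
  rw [← l2_translate X l, ← l2_smul]
  rfl

/-- There are `n + 1` positions for the factor `B`; Young's inequality puts it in `ℓ²` and the other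
`n` factors in `ℓ¹`. -/
lemma l2_convLin_le [AddCommGroup K] (V B : K → ℝ≥0∞) (n : ℕ) :
    l2 (convLin V B (n + 1)) ≤ ((n : ℝ≥0∞) + 1) * (∑' k, V k) ^ n * l2 B := by
  have key (n : ℕ) : l2 (conv B (convPow V n)) ≤ (∑' k, V k) ^ n * l2 B := by
    rw [conv_comm, ← tsum_convPow]
    exact l2_conv_le _ _
  induction n with
  | zero =>
    refine (l2_add_le _ _).trans ?_
    have h0 : l2 (conv V (convLin V B 0)) = 0 := by simp [convLin, conv, l2]
    simpa [h0] using key 0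
  | succ n ih =>
    refine (l2_add_le _ _).trans ((add_le_add (key _) ((l2_conv_le _ _).trans
      (mul_le_mul_right ih _))).trans (le_of_eq ?_))
    push_cast
    ring

end SquareSum

/-! ### Moving a weight onto one factor of a convolution power -/

section WeightedPower

variable {K : Type*} [AddCommGroup K]

lemma convPow_support {ℓ : K → ℝ} (hℓ : ∀ k l, ℓ k ≤ ℓ l + ℓ (k - l)) (h0 : ℓ 0 ≤ 0)
    {A : K → ℝ≥0∞} {R : ℝ} (hA : ∀ l, A l ≠ 0 → ℓ l < R) (n : ℕ) (k : K)
    (h : convPow A (n + 1) k ≠ 0) : ℓ k < (n + 1) * R := by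
  classical
  induction n generalizing k with
  | zero =>
    obtain ⟨l, h1, h2⟩ := exists_of_conv_ne_zero h
    have h3 : k - l = 0 := by
      by_contra hne
      exact h2 (by simp [convPow, hne])
    have := hℓ k l
    rw [h3] at this
    have := hA l h1
    simp
    linarith
  | succ n ih =>
    obtain ⟨l, h1, h2⟩ := exists_of_conv_ne_zero h
    have := hℓ k l
    have := hA l h1
    have := ih _ h2
    push_cast
    linarith

/-- Among `n` summands of `k` one has at least the `n`-th part of its length; hence a weight `q`
with `q k ≤ c * q l` for `|k| ≤ n |l|` can be moved onto one factor of a convolution power. -/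
lemma weight_mul_convPow_le {ℓ : K → ℝ} (hℓ : ∀ k l, ℓ k ≤ ℓ l + ℓ (k - l)) (h0 : ℓ 0 ≤ 0)
    {q : K → ℝ≥0∞} {n : ℕ} {c : ℝ≥0∞}
    (hq : ∀ k l, ℓ k ≤ (n + 1) * ℓ l → q k ≤ c * q l) (V : K → ℝ≥0∞) (k : K) :
    q k * convPow V (n + 1) k ≤ c * convLin V (q * V) (n + 1) k := by
  classical
  set A : K → ℝ≥0∞ := fun l => if ℓ k ≤ (n + 1) * ℓ l then 0 else V l with hAdef
  set B : K → ℝ≥0∞ := fun l => if ℓ k ≤ (n + 1) * ℓ l then V l else 0 with hBdef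
  have hAB : A + B = V := by
    ext l
    by_cases h : ℓ k ≤ (n + 1) * ℓ l <;> simp [hAdef, hBdef, h]
  -- `A` keeps only frequencies shorter than `ℓ k / (n + 1)`, and `n + 1` of these cannot add up to
  -- `k`. Hence only words with a factor `B` survive.
  have hA0 : convPow A (n + 1) k = 0 := by
    by_contra hne
    have hpos : (0 : ℝ) < n + 1 := by positivity
    have := convPow_support (R := ℓ k / (n + 1)) hℓ h0 (fun l hl => ?_) n k hne
    · rw [mul_div_cancel₀ _ hpos.ne'] at this
      exact lt_irrefl _ this
    · rw [lt_div_iff₀ hpos]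
      by_contra! hc
      exact hl (by simp only [hAdef]; rw [if_pos (by linarith)])
  have h1 := convPow_add_le A B (n + 1) k
  rw [hAB, Pi.add_apply, hA0, zero_add] at h1
  calc q k * convPow V (n + 1) k ≤ q k * convLin V B (n + 1) k := by gcongr
    _ = convLin V (q k • B) (n + 1) k := by rw [convLin_smul]; rfl
    _ ≤ convLin V (c • (q * V)) (n + 1) k := by
      refine convLin_mono (fun l => ?_) _ _
      by_cases h : ℓ k ≤ (n + 1) * ℓ l
      · simp only [hBdef, Pi.smul_apply, Pi.mul_apply, smul_eq_mul, if_pos h, ← mul_assoc]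
        gcongr
        exact hq k l h
      · simp [hBdef, h]
    _ = _ := by rw [convLin_smul]; rfl

/-- The majorant `∑_{n ≥ 1} α_n V^{*n}` of a power series without constant term. -/
def majorant (α : ℕ → ℝ≥0∞) (V : K → ℝ≥0∞) (k : K) : ℝ≥0∞ :=
  ∑' n : ℕ, α (n + 1) * convPow V (n + 1) k

lemma majorant_mono (α : ℕ → ℝ≥0∞) {V V' : K → ℝ≥0∞} (h : V ≤ V') :
    majorant α V ≤ majorant α V' :=
  fun k => ENNReal.tsum_le_tsum fun n => by gcongr; exact convPow_mono h _ k

/-- In degree `n + 1` the factor `c n` pays for transferring the weight and `n + 1` for the choice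
of the factor that receives it. -/
lemma l2_weight_majorant_le {ℓ : K → ℝ} (hℓ : ∀ k l, ℓ k ≤ ℓ l + ℓ (k - l)) (h0 : ℓ 0 ≤ 0)
    {q : K → ℝ≥0∞} {c : ℕ → ℝ≥0∞}
    (hq : ∀ (n : ℕ) k l, ℓ k ≤ (n + 1) * ℓ l → q k ≤ c n * q l) (α : ℕ → ℝ≥0∞)
    (V : K → ℝ≥0∞) :
    l2 (q * majorant α V) ≤
      (∑' n : ℕ, α (n + 1) * (c n * (n + 1)) * (∑' k, V k) ^ n) * l2 (q * V) := by
  calc l2 (q * majorant α V)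
      ≤ l2 (fun k => ∑' n : ℕ, ((α (n + 1) * c n) • convLin V (q * V) (n + 1)) k) := by
        refine l2_mono fun k => ?_
        simp only [majorant, Pi.mul_apply, ← ENNReal.tsum_mul_left, Pi.smul_apply, smul_eq_mul]
        refine ENNReal.tsum_le_tsum fun n => ?_
        calc _ = α (n + 1) * (q k * convPow V (n + 1) k) := by ring
          _ ≤ α (n + 1) * (c n * convLin V (q * V) (n + 1) k) := by
            exact mul_le_mul' le_rfl (weight_mul_convPow_le hℓ h0 (hq n) V k)
          _ = _ := by ring
    _ ≤ ∑' n : ℕ, l2 ((α (n + 1) * c n) • convLin V (q * V) (n + 1)) := l2_tsum_le _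
    _ ≤ _ := by
      rw [← ENNReal.tsum_mul_right]
      refine ENNReal.tsum_le_tsum fun n => ?_
      rw [l2_smul]
      refine (mul_le_mul_right (l2_convLin_le _ _ _) _).trans (le_of_eq ?_)
      ring

end WeightedPower

/-! ### Fourier coefficients and absolutely convergent Fourier series on the torus -/

section Fourier

variable {d : ℕ}

/-- The character `x ↦ exp(i k·x)` as a continuous function. -/
def character (k : Fin d → ℤ) : C(Torus d, ℂ) where
  toFun x := ∏ i, fourier (k i) (x i)
  continuous_toFun := by fun_prop

lemma character_apply (k : Fin d → ℤ) (x : Torus d) :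
    character k x = ∏ i, fourier (k i) (x i) := rfl

lemma character_add (k l : Fin d → ℤ) : character (k + l) = character k * character l := by
  ext x
  simp [character_apply, Finset.prod_mul_distrib]

lemma character_zero : character (0 : Fin d → ℤ) = 1 := by
  ext x
  simp [character_apply]

lemma norm_character_apply (k : Fin d → ℤ) (x : Torus d) : ‖character k x‖ = 1 := by
  simp only [character_apply, fourier_apply, norm_prod, Circle.norm_coe, Finset.prod_const_one]

lemma norm_character_le (k : Fin d → ℤ) : ‖character k‖ ≤ 1 :=
  (ContinuousMap.norm_le _ zero_le_one).2 fun x => (norm_character_apply k x).le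

lemma character_neg_apply (k : Fin d → ℤ) (x : Torus d) :
    character (-k) x = star (character k x) := by
  simp only [character_apply, Pi.neg_apply, fourier_neg, ← starRingEnd_apply, map_prod]

lemma volume_real_torus : (volume : Measure (Torus d)).real univ = (2 * Real.pi) ^ d := by
  simp [Measure.real, volume_pi, Measure.pi_univ, AddCircle.measure_univ, Real.pi_pos.le,
    ENNReal.toReal_ofReal]

lemma integral_character (k : Fin d → ℤ) :
    ∫ x, character k x = if k = 0 then (2 * Real.pi : ℂ) ^ d else 0 := by
  split_ifs with h
  · subst h
    simp [character_zero, volume_real_torus]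
  · obtain ⟨i, hi⟩ := Function.ne_iff.mp h
    simp only [character_apply]
    rw [integral_fintype_prod_volume_eq_prod (fun i (x : AddCircle (2 * Real.pi)) =>
      (fourier (k i) x : ℂ))]
    refine Finset.prod_eq_zero (Finset.mem_univ i) ?_
    exact integral_eq_zero_of_add_right_eq_neg
      (fourier_add_half_inv_index hi Real.two_pi_pos)

lemma integrable_continuousMap (f : C(Torus d, ℂ)) : Integrable f (volume : Measure (Torus d)) :=
  f.continuous.integrable_of_hasCompactSupport (HasCompactSupport.of_compactSpace _)

lemma coeff_eq (f : Torus d → ℂ) (k : Fin d → ℤ) :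
    coeff f k = ((2 * Real.pi : ℂ) ^ d)⁻¹ * ∫ x, f x * character (-k) x := rfl

lemma norm_coeff_le (f : C(Torus d, ℂ)) (k : Fin d → ℤ) : ‖coeff f k‖ ≤ ‖f‖ := by
  have h : ‖∫ x, f x * character (-k) x‖ ≤ ‖f‖ * (2 * Real.pi) ^ d := by
    rw [← volume_real_torus]
    refine norm_integral_le_of_norm_le_const (Eventually.of_forall fun x => ?_)
    rw [norm_mul, norm_character_apply, mul_one]
    exact f.norm_coe_le_norm x
  have hpos : (0 : ℝ) < (2 * Real.pi) ^ d := by positivity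
  have hn : ‖(2 * Real.pi : ℂ) ^ d‖ = (2 * Real.pi) ^ d := by
    simp [abs_of_pos Real.pi_pos]
  rw [coeff_eq, norm_mul, norm_inv, hn, inv_mul_le_iff₀ hpos]
  exact h.trans_eq (mul_comm _ _)

/-- The `k`-th Fourier coefficient as a continuous linear functional. -/
def coeffCLM (k : Fin d → ℤ) : C(Torus d, ℂ) →L[ℂ] ℂ :=
  LinearMap.mkContinuous
    { toFun := fun f => coeff f k
      map_add' := fun f g => by
        simp only [coeff_eq, ContinuousMap.coe_add, Pi.add_apply, add_mul]
        rw [← mul_add]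
        exact congrArg _ (integral_add (integrable_continuousMap (f * character (-k)))
          (integrable_continuousMap (g * character (-k))))
      map_smul' := fun c f => by
        simp only [coeff_eq, ContinuousMap.coe_smul, Pi.smul_apply, smul_eq_mul, mul_assoc,
          integral_const_mul, RingHom.id_apply]
        ring }
    1 (fun f => by simpa using norm_coeff_le f k)

lemma coeffCLM_apply (k : Fin d → ℤ) (f : C(Torus d, ℂ)) : coeffCLM k f = coeff f k := rfl

lemma coeff_character_mul (l k : Fin d → ℤ) (g : C(Torus d, ℂ)) :
    coeffCLM k (character l * g) = coeffCLM (k - l) g := by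
  simp only [coeffCLM_apply, coeff_eq, neg_sub, sub_eq_add_neg l k, character_add,
    ContinuousMap.mul_apply]
  congr 2
  ext x
  ring

lemma coeff_character (l k : Fin d → ℤ) :
    coeffCLM k (character l) = if k = l then 1 else 0 := by
  have h := coeff_character_mul l k 1
  rw [mul_one] at h
  rw [h, coeffCLM_apply, coeff_eq]
  simp only [ContinuousMap.one_apply, one_mul, integral_character, neg_sub, sub_eq_zero]
  have : (2 * Real.pi : ℂ) ^ d ≠ 0 := pow_ne_zero _ (by simp [Real.pi_ne_zero])
  by_cases hkl : k = l
  · simp [hkl, this]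
  · simp [hkl, Ne.symm hkl]

/-- The trigonometric polynomials form a star subalgebra. -/
def trigSubalgebra (d : ℕ) : StarSubalgebra ℂ C(Torus d, ℂ) where
  toSubalgebra := Algebra.adjoin ℂ (range character)
  star_mem' := by
    change Algebra.adjoin ℂ (range character) ≤ star (Algebra.adjoin ℂ (range character))
    refine Algebra.adjoin_le ?_
    rintro _ ⟨n, rfl⟩
    refine Algebra.subset_adjoin ⟨-n, ?_⟩
    ext1 x
    simp only [character_neg_apply, ContinuousMap.star_apply]

/-- Stone–Weierstrass: products and conjugates of characters are characters, so their span is the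
star algebra they generate, and the coordinate characters separate points. -/
lemma span_character_dense :
    (Submodule.span ℂ (range (character (d := d)))).topologicalClosure = ⊤ := by
  have h1 : (trigSubalgebra d).toSubalgebra.toSubmodule = Submodule.span ℂ (range character) := by
    apply Algebra.adjoin_eq_span_of_subset
    refine .trans (fun x => Submonoid.closure_induction (fun _ => id) ⟨0, character_zero⟩ ?_)
      Submodule.subset_span
    rintro _ _ _ _ ⟨m, rfl⟩ ⟨n, rfl⟩
    exact ⟨m + n, character_add m n⟩
  have h2 : (trigSubalgebra d).SeparatesPoints := by
    intro x y hxy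
    obtain ⟨i, hi⟩ := Function.ne_iff.mp hxy
    have hs (z : Torus d) : character (Pi.single i 1) z = fourier 1 (z i) := by
      rw [character_apply, Finset.prod_eq_single i]
      · simp
      · intro j _ hj
        simp [Pi.single_eq_of_ne hj]
      · simp
    refine ⟨_, ⟨character (Pi.single i 1), Algebra.subset_adjoin ⟨Pi.single i 1, rfl⟩, rfl⟩, ?_⟩
    dsimp only
    rw [hs, hs, fourier_one, fourier_one]
    exact fun h => hi (AddCircle.injective_toCircle Real.two_pi_pos.ne' (Subtype.coe_injective h))
  rw [← h1]
  exact congr_arg (Subalgebra.toSubmodule <| StarSubalgebra.toSubalgebra ·)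
    (ContinuousMap.starSubalgebra_topologicalClosure_eq_top_of_separatesPoints _ h2)

/-- Square integrable functions are determined by their Fourier coefficients. -/
lemma ae_eq_zero_of_coeff_eq_zero {f : Torus d → ℂ} (hf : MemLp f 2 volume)
    (h : ∀ k, coeff f k = 0) : f =ᵐ[volume] 0 := by
  have hdense := (ContinuousMap.toLp_denseRange ℂ (volume : Measure (Torus d)) ℂ
    (p := 2) (by simp)).topologicalClosure_map_submodule span_character_dense
  have hort : hf.toLp f ∈ ((Submodule.map (ContinuousMap.toLp 2 volume ℂ).toLinearMap
      (Submodule.span ℂ (range (character (d := d)))))).orthogonal := by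
    rw [Submodule.mem_orthogonal]
    rintro _ ⟨g, hg, rfl⟩
    induction hg using Submodule.span_induction with
    | zero => simp
    | add x y _ _ hx hy => rw [map_add, inner_add_left, hx, hy, add_zero]
    | smul c x _ hx => rw [map_smul, inner_smul_left, hx, mul_zero]
    | mem x hx =>
      obtain ⟨k, rfl⟩ := hx
      have hk := h k
      rw [coeff_eq, mul_eq_zero, or_iff_right (inv_ne_zero (pow_ne_zero _
        (by simp [Real.pi_ne_zero])))] at hk
      rw [L2.inner_def, ← hk]
      refine integral_congr_ae ?_
      filter_upwards [hf.coeFn_toLp, ContinuousMap.coeFn_toLp (p := 2) (𝕜 := ℂ) volume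
        (character k)] with x h1 h2
      rw [h1]
      erw [h2]
      rw [character_neg_apply, RCLike.inner_apply]
      rfl
  rw [← Submodule.orthogonal_closure, hdense, Submodule.top_orthogonal_eq_bot,
    Submodule.mem_bot] at hort
  have h3 := hf.coeFn_toLp
  rw [hort] at h3
  exact h3.symm.trans (Lp.coeFn_zero _ _ _)

lemma eq_zero_of_coeff_eq_zero {f : C(Torus d, ℂ)} (h : ∀ k, coeffCLM k f = 0) : f = 0 := by
  have h1 : (f : Torus d → ℂ) =ᵐ[volume] 0 :=
    ae_eq_zero_of_coeff_eq_zero (f.continuous.memLp_of_hasCompactSupport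
      (HasCompactSupport.of_compactSpace _)) h
  exact DFunLike.coe_injective ((Continuous.ae_eq_iff_eq volume f.continuous
    continuous_const).1 h1)

/-- The sum of the Fourier series with coefficients `c`. -/
def fourierSum (c : (Fin d → ℤ) → ℂ) : C(Torus d, ℂ) := ∑' k, c k • character k

lemma norm_smul_character_le (c : ℂ) (k : Fin d → ℤ) : ‖c • character k‖ ≤ ‖c‖ := by
  rw [norm_smul]
  exact mul_le_of_le_one_right (norm_nonneg _) (norm_character_le k)

lemma hasSum_fourierSum {c : (Fin d → ℤ) → ℂ} (hc : Summable fun k => ‖c k‖) :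
    HasSum (fun k => c k • character k) (fourierSum c) :=
  (Summable.of_norm_bounded hc fun _ => norm_smul_character_le _ _).hasSum

lemma coeff_fourierSum_mul {c : (Fin d → ℤ) → ℂ} (hc : Summable fun k => ‖c k‖)
    (g : C(Torus d, ℂ)) (k : Fin d → ℤ) :
    HasSum (fun l => c l * coeffCLM (k - l) g) (coeffCLM k (fourierSum c * g)) := by
  have h := ((hasSum_fourierSum hc).mul_right g).mapL (coeffCLM k)
  simpa only [smul_mul_assoc, map_smul, coeff_character_mul, smul_eq_mul] using h

lemma coeff_fourierSum {c : (Fin d → ℤ) → ℂ} (hc : Summable fun k => ‖c k‖) (k : Fin d → ℤ) :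
    coeffCLM k (fourierSum c) = c k := by
  have h := (hasSum_fourierSum hc).mapL (coeffCLM k)
  simp only [map_smul, coeff_character, smul_eq_mul, mul_ite, mul_one, mul_zero] at h
  exact h.unique (hasSum_ite_eq k (c k) |>.congr_fun fun b => by
    by_cases hb : b = k
    · simp [hb]
    · simp [hb, Ne.symm hb])

lemma summable_of_tsum_enorm {K : Type*} {c : K → ℂ} (hc : ∑' k, ‖c k‖ₑ ≠ ∞) :
    Summable fun k => ‖c k‖ := by
  simpa using ENNReal.summable_toReal hc

lemma enorm_fourierSum_le {c : (Fin d → ℤ) → ℂ} : ‖fourierSum c‖ₑ ≤ ∑' k, ‖c k‖ₑ := by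
  by_cases hc : ∑' k, ‖c k‖ₑ = ∞
  · simp [hc]
  have hs := summable_of_tsum_enorm hc
  have h : ‖fourierSum c‖ ≤ ∑' k, ‖c k‖ :=
    tsum_of_norm_bounded hs.hasSum fun k => norm_smul_character_le _ _
  calc ‖fourierSum c‖ₑ = ENNReal.ofReal ‖fourierSum c‖ := (ofReal_norm _).symm
    _ ≤ ENNReal.ofReal (∑' k, ‖c k‖) := ENNReal.ofReal_le_ofReal h
    _ = ∑' k, ‖c k‖ₑ := by
      rw [ENNReal.ofReal_tsum_of_nonneg (fun _ => norm_nonneg _) hs]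
      simp

lemma fourierSum_sub {c c' : (Fin d → ℤ) → ℂ} (hc : Summable fun k => ‖c k‖)
    (hc' : Summable fun k => ‖c' k‖) : fourierSum (c - c') = fourierSum c - fourierSum c' := by
  have := (hasSum_fourierSum hc).sub (hasSum_fourierSum hc')
  simp only [← sub_smul] at this
  exact this.tsum_eq

end Fourier

/-! ### Frequency weights and the Wiener embedding -/

section Frequencies

variable {d : ℕ}

lemma freqNorm_eq (k : Fin d → ℤ) :
    freqNorm k = ‖(WithLp.toLp 2 fun i => (k i : ℝ) : EuclideanSpace ℝ (Fin d))‖ := by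
  simp [freqNorm, EuclideanSpace.norm_eq]

lemma freqNorm_nonneg (k : Fin d → ℤ) : 0 ≤ freqNorm k := Real.sqrt_nonneg _

lemma freqNorm_zero : freqNorm (0 : Fin d → ℤ) = 0 := by simp [freqNorm]

lemma freqNorm_le_add (k l : Fin d → ℤ) : freqNorm k ≤ freqNorm l + freqNorm (k - l) := by
  simp only [freqNorm_eq]
  convert! norm_add_le (E := EuclideanSpace ℝ (Fin d)) _ _ using 2
  ext i
  simp

lemma one_le_freqNorm {k : Fin d → ℤ} (hk : k ≠ 0) : 1 ≤ freqNorm k := by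
  obtain ⟨i, hi⟩ := Function.ne_iff.mp hk
  rw [freqNorm, Real.one_le_sqrt]
  have h1 : (1 : ℝ) ≤ (k i : ℝ) ^ 2 := by
    rw [one_le_sq_iff_one_le_abs]
    exact_mod_cast Int.one_le_abs hi
  exact h1.trans (Finset.single_le_sum (f := fun i => (k i : ℝ) ^ 2)
    (fun _ _ => sq_nonneg _) (Finset.mem_univ i))

lemma summable_freqNorm_rpow {s : ℝ} (hs : (d : ℝ) < s) :
    Summable fun k : Fin d → ℤ => freqNorm k ^ (-s) := by
  classical
  let b := (EuclideanSpace.basisFun (Fin d) ℝ).toBasis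
  let L := Submodule.span ℤ (Set.range b)
  have hmem (k : Fin d → ℤ) :
      (WithLp.toLp 2 fun i => (k i : ℝ) : EuclideanSpace ℝ (Fin d)) ∈ L := by
    have : (WithLp.toLp 2 fun i => (k i : ℝ) : EuclideanSpace ℝ (Fin d)) = ∑ i, k i • b i := by
      ext j
      simp [b, Finset.sum_apply, Pi.single_apply]
    rw [this]
    exact Submodule.sum_mem _ fun i _ => Submodule.smul_mem _ _ (Submodule.subset_span ⟨i, rfl⟩)
  have hrank : Module.finrank ℤ L = d := by
    rw [ZLattice.rank ℝ L]
    simp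
  have h := ZLattice.summable_norm_rpow L (-s) (by rw [hrank]; linarith)
  have hinj : Function.Injective fun k : Fin d → ℤ => (⟨_, hmem k⟩ : L) := by
    intro k l hkl
    ext i
    have := congrArg (fun x : EuclideanSpace ℝ (Fin d) => x i) (Subtype.ext_iff.1 hkl)
    simpa using this
  refine (h.comp_injective hinj).congr fun k => ?_
  simp [freqNorm_eq]

/-- The lattice sum of `|k|^{-(2r-1)}` converges because `2r - 1 > d`. -/
lemma wienerConst_ne_top {r : ℝ} (hr : ((d : ℝ) + 1) / 2 < r) : wienerConst d r ≠ ∞ := by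
  refine ENNReal.rpow_ne_top_of_nonneg (by norm_num) (ENNReal.mul_ne_top ENNReal.ofReal_ne_top ?_)
  exact ((summable_freqNorm_rpow (s := 2 * r - 1) (by linarith)).comp_injective
    Subtype.val_injective).tsum_ofReal_ne_top

/-- The weight `(2π)^{d/2} |k|^r` of the Sobolev norm of order `r`. -/
def sobolevWeight (r : ℝ) (k : Fin d → ℤ) : ℝ≥0∞ :=
  ENNReal.ofReal (Real.sqrt ((2 * Real.pi) ^ d) * freqNorm k ^ r)

lemma sobolevWeight_sq (r : ℝ) (k : Fin d → ℤ) : sobolevWeight r k ^ 2 =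
    ENNReal.ofReal ((2 * Real.pi) ^ d) * ENNReal.ofReal (freqNorm k ^ (2 * r)) := by
  have := freqNorm_nonneg k
  have h : (0 : ℝ) ≤ (2 * Real.pi) ^ d := by positivity
  rw [sobolevWeight, ← ENNReal.ofReal_pow (by positivity), mul_pow, Real.sq_sqrt h,
    ENNReal.ofReal_mul h, ← Real.rpow_natCast (freqNorm k ^ r), ← Real.rpow_mul this,
    Nat.cast_ofNat, mul_comm r]

lemma gevreyNorm_eq (r β : ℝ) (f : Torus d → ℂ) : gevreyNorm r β f =
    l2 (sobolevWeight r * fun k => ENNReal.ofReal (Real.exp (β * freqNorm k)) * ‖coeff f k‖ₑ) := by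
  rw [gevreyNorm, l2, ← ENNReal.tsum_mul_left]
  refine congrArg (· ^ (1 / 2 : ℝ)) (tsum_congr fun k => ?_)
  have := freqNorm_nonneg k
  rw [Pi.mul_apply, mul_pow (sobolevWeight r k), sobolevWeight_sq, mul_pow (ENNReal.ofReal _),
    ENNReal.ofReal_mul (by positivity),
    ENNReal.ofReal_mul (by positivity), ENNReal.ofReal_pow (norm_nonneg _), ofReal_norm,
    ← ENNReal.ofReal_pow (Real.exp_nonneg _), ← Real.exp_nat_mul]
  push_cast
  ring_nf

lemma l2_comp_le {J K : Type*} {f : J → K} (hf : Function.Injective f) (X : K → ℝ≥0∞) :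
    l2 (fun j => X (f j)) ≤ l2 X :=
  ENNReal.rpow_le_rpow (ENNReal.tsum_comp_le_tsum_of_injective hf fun k => X k ^ 2) (by norm_num)

lemma wienerConst_eq (d : ℕ) (r : ℝ) : wienerConst d r =
    l2 fun k : {k : Fin d → ℤ // k ≠ 0} =>
      ENNReal.ofReal ((Real.sqrt ((2 * Real.pi) ^ d))⁻¹ * freqNorm k.1 ^ (-(r - 1 / 2))) := by
  have hpos : (0 : ℝ) < (2 * Real.pi) ^ d := by positivity
  rw [wienerConst, l2, ← ENNReal.tsum_mul_left]
  refine congrArg (· ^ (1 / 2 : ℝ)) (tsum_congr fun k => ?_)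
  have := freqNorm_nonneg k.1
  rw [← ENNReal.ofReal_mul (by positivity), ← ENNReal.ofReal_pow (by positivity),
    mul_pow (Real.sqrt _)⁻¹, inv_pow, Real.sq_sqrt hpos.le,
    ← Real.rpow_natCast (freqNorm k.1 ^ _), ← Real.rpow_mul this]
  congr 3
  push_cast
  ring

/-- Cauchy–Schwarz against `|k|^{-(r-1/2)}`. The constant belongs to Sobolev order `r - 1/2`; the
remaining `|k|^{1/2}` is at least `1` away from zero frequency and is discarded. -/
lemma tsum_le_wienerConst_mul {r : ℝ} {V : (Fin d → ℤ) → ℝ≥0∞} (hV : V 0 = 0) :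
    ∑' k, V k ≤ wienerConst d r * l2 (sobolevWeight r * V) := by
  set y : {k : Fin d → ℤ // k ≠ 0} → ℝ≥0∞ := fun k =>
    ENNReal.ofReal ((Real.sqrt ((2 * Real.pi) ^ d))⁻¹ * freqNorm k.1 ^ (-(r - 1 / 2))) with hy
  have hW : wienerConst d r = l2 y := wienerConst_eq d r
  have hsub : ∑' k, V k = ∑' k : {k : Fin d → ℤ // k ≠ 0}, V k := by
    refine (tsum_subtype_eq_of_support_subset (s := {k | k ≠ 0}) fun k hk => ?_).symm
    rintro rfl
    exact hk hV
  calc ∑' k, V k = ∑' k : {k : Fin d → ℤ // k ≠ 0}, V k := hsub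
    _ ≤ ∑' k : {k : Fin d → ℤ // k ≠ 0}, y k * (sobolevWeight r k.1 * V k.1) := by
      refine ENNReal.tsum_le_tsum fun k => ?_
      have h1 := one_le_freqNorm k.2
      have h0 : 0 < freqNorm k.1 := by linarith
      rw [← mul_assoc]
      refine le_mul_of_one_le_left zero_le ?_
      rw [hy, sobolevWeight, ← ENNReal.ofReal_mul (by positivity), ← ENNReal.ofReal_one]
      refine ENNReal.ofReal_le_ofReal ?_
      have : (Real.sqrt ((2 * Real.pi) ^ d))⁻¹ * freqNorm k.1 ^ (-(r - 1 / 2)) *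
          (Real.sqrt ((2 * Real.pi) ^ d) * freqNorm k.1 ^ r) = freqNorm k.1 ^ (1 / 2 : ℝ) := by
        have hs : Real.sqrt ((2 * Real.pi) ^ d) ≠ 0 := by positivity
        rw [mul_mul_mul_comm, inv_mul_cancel₀ hs, one_mul, ← Real.rpow_add h0]
        congr 1
        ring
      rw [this]
      exact Real.one_le_rpow h1 (by norm_num)
    _ ≤ l2 y * l2 (fun k : {k : Fin d → ℤ // k ≠ 0} => sobolevWeight r k.1 * V k.1) :=
      tsum_mul_le_l2 y fun k => sobolevWeight r k.1 * V k.1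
    _ ≤ wienerConst d r * l2 (sobolevWeight r * V) := by
      rw [← hW]
      have hl : l2 (fun k : {k : Fin d → ℤ // k ≠ 0} => sobolevWeight r k.1 * V k.1) ≤
          l2 (sobolevWeight r * V) :=
        l2_comp_le (f := Subtype.val) Subtype.val_injective (sobolevWeight r * V)
      gcongr

/-- The exponential factor `exp(-b|k|)`. -/
def damping (b : ℝ) (k : Fin d → ℤ) : ℝ≥0∞ := ENNReal.ofReal (Real.exp (-(b * freqNorm k)))

/-- The complementary factor `1 - exp(-b|k|)`. -/
def smoothing (b : ℝ) (k : Fin d → ℤ) : ℝ≥0∞ := ENNReal.ofReal (1 - Real.exp (-(b * freqNorm k)))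

lemma exp_neg_mul_freqNorm_le_one {b : ℝ} (hb : 0 ≤ b) (k : Fin d → ℤ) :
    Real.exp (-(b * freqNorm k)) ≤ 1 :=
  Real.exp_le_one_iff.2 (neg_nonpos.2 (mul_nonneg hb (freqNorm_nonneg k)))

lemma damping_add_smoothing {b : ℝ} (hb : 0 ≤ b) (k : Fin d → ℤ) :
    damping b k + smoothing b k = 1 := by
  rw [damping, smoothing, ← ENNReal.ofReal_add (Real.exp_nonneg _)
    (sub_nonneg.2 (exp_neg_mul_freqNorm_le_one hb k))]
  simp

/-- The Sobolev weight times `(1 - exp(-b|k|))^{1/2}`. -/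
def smoothWeight (r b : ℝ) (k : Fin d → ℤ) : ℝ≥0∞ :=
  ENNReal.ofReal (Real.sqrt ((2 * Real.pi) ^ d) * freqNorm k ^ r *
    Real.sqrt (1 - Real.exp (-(b * freqNorm k))))

/-- The square root in the weight is chosen for this identity: in squared norms the smoothing factor
of the recursion is absorbed exactly. -/
lemma smoothWeight_sq (r : ℝ) {b : ℝ} (hb : 0 ≤ b) (k : Fin d → ℤ) :
    smoothWeight r b k ^ 2 = sobolevWeight r k ^ 2 * smoothing b k := by
  have := freqNorm_nonneg k
  have h := sub_nonneg.2 (exp_neg_mul_freqNorm_le_one hb k)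
  rw [smoothWeight, sobolevWeight, smoothing, ← ENNReal.ofReal_pow (by positivity), mul_pow,
    Real.sq_sqrt h, ENNReal.ofReal_mul (by positivity), ENNReal.ofReal_pow (by positivity)]

/-- The power of `|k|` costs `(n+1)^r`. With `x = exp(-b|l|)`, Bernoulli's inequality gives `1 -
x^{n+1} ≤ (n+1)(1 - x)`, which after the square root costs only `(n+1)^{1/2}`, uniformly in `b`. -/
lemma smoothWeight_le {r b : ℝ} (hr : 0 ≤ r) (hb : 0 ≤ b) (n : ℕ) (k l : Fin d → ℤ)
    (hkl : freqNorm k ≤ (n + 1) * freqNorm l) :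
    smoothWeight r b k ≤ ENNReal.ofReal (((n : ℝ) + 1) ^ (r + 1 / 2)) * smoothWeight r b l := by
  have hk := freqNorm_nonneg k
  have hl := freqNorm_nonneg l
  have hn : (0 : ℝ) < n + 1 := by positivity
  rw [smoothWeight, smoothWeight, ← ENNReal.ofReal_mul (by positivity)]
  refine ENNReal.ofReal_le_ofReal ?_
  have h1 : freqNorm k ^ r ≤ ((n : ℝ) + 1) ^ r * freqNorm l ^ r := by
    rw [← Real.mul_rpow hn.le hl]
    exact Real.rpow_le_rpow hk hkl hr
  have h2 : 1 - Real.exp (-(b * freqNorm k)) ≤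
      ((n : ℝ) + 1) * (1 - Real.exp (-(b * freqNorm l))) := by
    have hB := one_add_mul_le_pow (a := Real.exp (-(b * freqNorm l)) - 1)
      (by linarith [Real.exp_nonneg (-(b * freqNorm l))]) (n + 1)
    rw [add_sub_cancel, ← Real.exp_nat_mul] at hB
    push_cast at hB
    have : Real.exp ((n + 1) * -(b * freqNorm l)) ≤ Real.exp (-(b * freqNorm k)) := by
      apply Real.exp_le_exp.2
      nlinarith [mul_le_mul_of_nonneg_left hkl hb]
    linarith
  have h3 := Real.sqrt_le_sqrt h2
  rw [Real.sqrt_mul hn.le] at h3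
  rw [Real.rpow_add hn, ← Real.sqrt_eq_rpow]
  calc _ ≤ Real.sqrt ((2 * Real.pi) ^ d) * (((n : ℝ) + 1) ^ r * freqNorm l ^ r) *
        (Real.sqrt (n + 1) * Real.sqrt (1 - Real.exp (-(b * freqNorm l)))) := by gcongr
    _ = _ := by ring

/-- The exponent `r + 3/2` in `Ftilde` is `r + 1/2` from moving the weight plus `1` from the number
of factors. -/
lemma l2_smoothWeight_majorant_le {r b : ℝ} (hr : 0 ≤ r) (hb : 0 ≤ b) (a : ℕ → ℝ)
    {V : (Fin d → ℤ) → ℝ≥0∞} {s : ℝ≥0∞} (hV : ∑' k, V k ≤ wienerConst d r * s) :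
    l2 (smoothWeight r b * majorant (fun n => ‖a n‖ₑ) V) ≤
      Ftilde d r a s * l2 (smoothWeight r b * V) := by
  refine (l2_weight_majorant_le freqNorm_le_add freqNorm_zero.le
    (smoothWeight_le hr hb) _ V).trans (mul_le_mul' (ENNReal.tsum_le_tsum fun n => ?_) le_rfl)
  have hn : (0 : ℝ) < n + 1 := by positivity
  have h1 : ENNReal.ofReal (((n : ℝ) + 1) ^ (r + 1 / 2)) * ((n : ℝ≥0∞) + 1) =
      ENNReal.ofReal (((n : ℝ) + 1) ^ (r + 3 / 2)) := by
    have : ((n : ℝ≥0∞) + 1) = ENNReal.ofReal ((n : ℝ) + 1) := by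
      rw [ENNReal.ofReal_add (by positivity) zero_le_one]
      simp
    rw [this, ← ENNReal.ofReal_mul (by positivity), ← Real.rpow_add_one hn.ne']
    congr 2
    ring
  rw [h1, mul_assoc _ (wienerConst d r ^ n), ← mul_pow]
  gcongr

end Frequencies

/-! ### The scalar majorant recursion and its limit -/

section Iteration

variable {d : ℕ}

/-- The majorants of the successive approximations. -/
def majorantIter (b : ℝ) (ε : ℝ≥0∞) (α : ℕ → ℝ≥0∞) (G : (Fin d → ℤ) → ℝ≥0∞) :
    ℕ → (Fin d → ℤ) → ℝ≥0∞
  | 0 => 0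
  | j + 1 => damping b * G + smoothing b * (ε • majorant α (majorantIter b ε α G j))

variable {b : ℝ} {ε : ℝ≥0∞} {α : ℕ → ℝ≥0∞} {G : (Fin d → ℤ) → ℝ≥0∞}

lemma majorantIter_mono : Monotone (majorantIter b ε α G) := by
  refine monotone_nat_of_le_succ fun j => ?_
  induction j with
  | zero => exact zero_le
  | succ j ih =>
    intro k
    simp only [majorantIter, Pi.add_apply, Pi.mul_apply, Pi.smul_apply, smul_eq_mul]
    gcongr
    exact majorant_mono α ih k

lemma majorantIter_zero (hG : G 0 = 0) (j : ℕ) : majorantIter b ε α G j 0 = 0 := by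
  cases j with
  | zero => rfl
  | succ j => simp [majorantIter, hG, smoothing, freqNorm_zero]

/-- Convexity of the square in `ℝ≥0∞`. -/
lemma sq_convex_combination_le {t s : ℝ≥0∞} (h : t + s = 1) (x y : ℝ≥0∞) :
    (t * x + s * y) ^ 2 ≤ t * x ^ 2 + s * y ^ 2 := by
  simpa using ENNReal.rpow_arith_mean_le_arith_mean2_rpow t s x y h (p := 2) (by norm_num)

/-- The Sobolev norm does not grow along the iteration: what the smoothing factor adds is
compensated by what the damping factor removes. -/
lemma majorantIter_bounds {r : ℝ} (hr : 0 ≤ r) (hb : 0 ≤ b) {a : ℕ → ℝ} (hG : G 0 = 0)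
    (hε : 2 * (ε * Ftilde d r a (l2 (sobolevWeight r * G))) ≤ 1) (j : ℕ) :
    l2 (sobolevWeight r * majorantIter b ε (fun n => ‖a n‖ₑ) G j) ≤ l2 (sobolevWeight r * G) ∧
    l2 (smoothWeight r b * majorantIter b ε (fun n => ‖a n‖ₑ) G j) ^ 2 ≤
      2 * l2 (smoothWeight r b * G) ^ 2 := by
  induction j with
  | zero => simp [majorantIter, l2]
  | succ j ih =>
    set V := majorantIter b ε (fun n => ‖a n‖ₑ) G j with hV
    set H := ε • majorant (fun n => ‖a n‖ₑ) V with hH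
    have hsum : ∑' k, V k ≤ wienerConst d r * l2 (sobolevWeight r * G) :=
      (tsum_le_wienerConst_mul (majorantIter_zero hG j)).trans (mul_le_mul' le_rfl ih.1)
    -- The gain of `2` absorbs the loss of `2` in the second bound of the induction: `4‖H‖² ≤ ‖V‖² ≤
    -- 2‖G‖²` in the smoothing norm, so `‖H‖ ≤ ‖G‖`.
    have h1 : 2 * l2 (smoothWeight r b * H) ≤ l2 (smoothWeight r b * V) := by
      rw [hH, mul_smul_comm, l2_smul]
      calc _ ≤ 2 * (ε * (Ftilde d r a (l2 (sobolevWeight r * G)) * l2 (smoothWeight r b * V))) := by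
            gcongr
            exact l2_smoothWeight_majorant_le hr hb a hsum
        _ = 2 * (ε * Ftilde d r a (l2 (sobolevWeight r * G))) * l2 (smoothWeight r b * V) := by
          ring
        _ ≤ _ := mul_le_of_le_one_left zero_le hε
    have h2 : l2 (smoothWeight r b * H) ^ 2 ≤ l2 (smoothWeight r b * G) ^ 2 := by
      have h3 := (pow_le_pow_left' h1 2).trans ih.2
      rw [mul_pow] at h3
      have h4 : (2 : ℝ≥0∞) * (2 * l2 (smoothWeight r b * H) ^ 2) ≤
          2 * l2 (smoothWeight r b * G) ^ 2 := by
        refine le_trans (le_of_eq ?_) h3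
        ring
      have h5 := (ENNReal.mul_le_mul_iff_right two_ne_zero ENNReal.ofNat_ne_top).1 h4
      exact le_trans (le_mul_of_one_le_left zero_le one_le_two) h5
    have hconv (k : Fin d → ℤ) : majorantIter b ε (fun n => ‖a n‖ₑ) G (j + 1) k ^ 2 ≤
        damping b k * G k ^ 2 + smoothing b k * H k ^ 2 :=
      sq_convex_combination_le (damping_add_smoothing hb k) _ _
    have hle := damping_add_smoothing (d := d) hb
    rw [l2_le_iff, l2_sq, l2_sq, l2_sq] at *
    simp only [Pi.mul_apply, mul_pow] at h2 ⊢
    constructor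
    -- Once `H` is replaced by `G` in the smoothing part, the damping and smoothing parts of the
    -- norm of `G` add up to that norm again, with no constant lost.
    · calc _ ≤ ∑' k, (sobolevWeight r k ^ 2 * damping b k * G k ^ 2 +
              smoothWeight r b k ^ 2 * H k ^ 2) := by
            refine ENNReal.tsum_le_tsum fun k => ?_
            refine (mul_le_mul' le_rfl (hconv k)).trans (le_of_eq ?_)
            rw [smoothWeight_sq r hb]
            ring
        _ ≤ ∑' k, sobolevWeight r k ^ 2 * damping b k * G k ^ 2 +
              ∑' k, smoothWeight r b k ^ 2 * G k ^ 2 := by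
            rw [ENNReal.tsum_add]
            gcongr
        _ = _ := by
            rw [← ENNReal.tsum_add]
            refine tsum_congr fun k => ?_
            rw [smoothWeight_sq r hb]
            calc _ = (damping b k + smoothing b k) * (sobolevWeight r k ^ 2 * G k ^ 2) := by ring
              _ = _ := by rw [hle, one_mul]
    · calc _ ≤ ∑' k, (smoothWeight r b k ^ 2 * G k ^ 2 + smoothWeight r b k ^ 2 * H k ^ 2) := by
            refine ENNReal.tsum_le_tsum fun k => ?_
            rw [← mul_add]
            refine mul_le_mul' le_rfl ((hconv k).trans (add_le_add ?_ ?_))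
            · exact mul_le_of_le_one_left zero_le ((hle k) ▸ le_self_add)
            · exact mul_le_of_le_one_left zero_le ((hle k) ▸ le_add_self)
        _ ≤ _ := by
            rw [ENNReal.tsum_add, two_mul]
            gcongr

/-- The limit of the majorants. -/
def majorantLimit (b : ℝ) (ε : ℝ≥0∞) (α : ℕ → ℝ≥0∞) (G : (Fin d → ℤ) → ℝ≥0∞) :
    (Fin d → ℤ) → ℝ≥0∞ :=
  ⨆ j, majorantIter b ε α G j

lemma le_majorantLimit (j : ℕ) : majorantIter b ε α G j ≤ majorantLimit b ε α G :=
  le_iSup (majorantIter b ε α G) j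

lemma tendsto_majorantIter (k : Fin d → ℤ) :
    Tendsto (fun j => majorantIter b ε α G j k) atTop (𝓝 (majorantLimit b ε α G k)) := by
  rw [majorantLimit, iSup_apply]
  exact tendsto_atTop_iSup fun i j hij => majorantIter_mono hij k

lemma majorantLimit_zero (hG : G 0 = 0) : majorantLimit b ε α G 0 = 0 := by
  simp [majorantLimit, iSup_apply, majorantIter_zero hG]

/-- Fatou's lemma for sums. -/
lemma tsum_le_of_tendsto {K : Type*} {f : ℕ → K → ℝ≥0∞} {g : K → ℝ≥0∞} {c : ℝ≥0∞}
    (h : ∀ k, Tendsto (fun j => f j k) atTop (𝓝 (g k))) (hf : ∀ j, ∑' k, f j k ≤ c) :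
    ∑' k, g k ≤ c := by
  refine ENNReal.summable.tsum_le_of_sum_le fun s => ?_
  exact le_of_tendsto' (tendsto_finsetSum s fun k _ => h k)
    fun j => (ENNReal.sum_le_tsum s).trans (hf j)

lemma l2_majorantLimit_le {r : ℝ} (hr : 0 ≤ r) (hb : 0 ≤ b) {a : ℕ → ℝ} (hG : G 0 = 0)
    (hε : 2 * (ε * Ftilde d r a (l2 (sobolevWeight r * G))) ≤ 1) :
    l2 (sobolevWeight r * majorantLimit b ε (fun n => ‖a n‖ₑ) G) ≤ l2 (sobolevWeight r * G) := by
  rw [l2_le_iff]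
  refine tsum_le_of_tendsto (fun k => ENNReal.Tendsto.pow (ENNReal.Tendsto.const_mul
    (tendsto_majorantIter k) (Or.inr ENNReal.ofReal_ne_top))) fun j => ?_
  exact l2_le_iff.1 (majorantIter_bounds hr hb hG hε j).1

lemma tendsto_tsum_majorantIter :
    Tendsto (fun j => ∑' k, majorantIter b ε α G j k) atTop
      (𝓝 (∑' k, majorantLimit b ε α G k)) := by
  have hmono : Monotone fun j => ∑' k, majorantIter b ε α G j k :=
    fun i j hij => ENNReal.tsum_le_tsum fun k => majorantIter_mono hij k
  have h : ∑' k, majorantLimit b ε α G k = ⨆ j, ∑' k, majorantIter b ε α G j k :=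
    le_antisymm (tsum_le_of_tendsto tendsto_majorantIter
        fun j => le_iSup (fun j => ∑' k, majorantIter b ε α G j k) j)
      (iSup_le fun j => ENNReal.tsum_le_tsum fun k => le_majorantLimit j k)
  rw [h]
  exact tendsto_atTop_iSup hmono

end Iteration

/-! ### The superposition operator on continuous functions -/

section Composition

variable {d : ℕ}

/-- The superposition operator `f ↦ F(f) = ∑_{n ≥ 1} a_n f^n` in the algebra of continuous
functions. -/
def superpose (a : ℕ → ℝ) (f : C(Torus d, ℂ)) : C(Torus d, ℂ) :=
  ∑' n : ℕ, (a (n + 1) : ℂ) • f ^ (n + 1)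

variable {a : ℕ → ℝ} {ρ : ℝ}

lemma norm_superpose_term_le {f : C(Torus d, ℂ)} (hf : ‖f‖ ≤ ρ) (n : ℕ) :
    ‖(a (n + 1) : ℂ) • f ^ (n + 1)‖ ≤ |a (n + 1)| * ρ ^ (n + 1) := by
  rw [norm_smul, Complex.norm_real, Real.norm_eq_abs]
  gcongr
  exact (norm_pow_le _ _).trans (by gcongr)

lemma hasSum_superpose (hρ : Summable fun n => |a (n + 1)| * ρ ^ (n + 1)) {f : C(Torus d, ℂ)}
    (hf : ‖f‖ ≤ ρ) : HasSum (fun n : ℕ => (a (n + 1) : ℂ) • f ^ (n + 1)) (superpose a f) :=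
  (Summable.of_norm_bounded hρ (norm_superpose_term_le hf)).hasSum

lemma superpose_apply (ha : a 0 = 0) (hρ : Summable fun n => |a (n + 1)| * ρ ^ (n + 1))
    {f : C(Torus d, ℂ)} (hf : ‖f‖ ≤ ρ) (x : Torus d) : superpose a f x = powerFun a (f x) := by
  have h := (hasSum_superpose hρ hf).mapL (ContinuousMap.evalCLM ℂ x)
  simp only [ContinuousMap.evalCLM_apply, ContinuousMap.coe_smul, Pi.smul_apply,
    ContinuousMap.coe_pow, Pi.pow_apply, smul_eq_mul] at h
  have h2 := (hasSum_nat_add_iff (f := fun n => (a n : ℂ) * f x ^ n) 1).1 h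
  simp only [Finset.range_one, Finset.sum_singleton, ha, Complex.ofReal_zero, zero_mul,
    add_zero] at h2
  exact h2.tsum_eq.symm

lemma superpose_zero : superpose a (0 : C(Torus d, ℂ)) = 0 := by
  simp [superpose]

lemma differentiableOn_superpose (hρ : Summable fun n => |a (n + 1)| * ρ ^ (n + 1)) {U : Set ℂ}
    (hU : IsOpen U) {u : ℂ → C(Torus d, ℂ)} (hu : DifferentiableOn ℂ u U)
    (hb : ∀ z ∈ U, ‖u z‖ ≤ ρ) : DifferentiableOn ℂ (fun z => superpose a (u z)) U :=
  Complex.differentiableOn_tsum_of_summable_norm hρ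
    (fun n => (hu.fun_pow (n + 1)).fun_const_smul _) hU
    fun n z hz => norm_superpose_term_le (hb z hz) n

lemma continuousOn_superpose (hρ : Summable fun n => |a (n + 1)| * ρ ^ (n + 1)) :
    ContinuousOn (superpose a : C(Torus d, ℂ) → _) {f | ‖f‖ ≤ ρ} :=
  continuousOn_tsum (fun n => by fun_prop) hρ fun n _ hf => norm_superpose_term_le hf n

lemma norm_pow_sub_pow_le {A : Type*} [NormedCommRing A] {f g : A} (hf : ‖f‖ ≤ ρ) (hg : ‖g‖ ≤ ρ)
    (n : ℕ) : ‖f ^ (n + 1) - g ^ (n + 1)‖ ≤ (n + 1) * ρ ^ n * ‖f - g‖ := by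
  have hρ : 0 ≤ ρ := (norm_nonneg f).trans hf
  induction n with
  | zero => simp
  | succ n ih =>
    have h : f ^ (n + 1 + 1) - g ^ (n + 1 + 1) =
        f ^ (n + 1) * (f - g) + (f ^ (n + 1) - g ^ (n + 1)) * g := by ring
    rw [h]
    calc _ ≤ ‖f ^ (n + 1)‖ * ‖f - g‖ + ‖f ^ (n + 1) - g ^ (n + 1)‖ * ‖g‖ :=
          (norm_add_le _ _).trans (add_le_add (norm_mul_le _ _) (norm_mul_le _ _))
      _ ≤ ρ ^ (n + 1) * ‖f - g‖ + (n + 1) * ρ ^ n * ‖f - g‖ * ρ := by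
          gcongr
          exact (norm_pow_le' f n.succ_pos).trans (by gcongr)
      _ = _ := by push_cast; ring

/-- The left side is one term of the binomial expansion of the right. It trades the factor `n + 1`
of a differentiated series for a larger radius. -/
lemma succ_mul_pow_mul_le {δ : ℝ} (hρ : 0 ≤ ρ) (hδ : 0 ≤ δ) (n : ℕ) :
    ((n : ℝ) + 1) * ρ ^ n * δ ≤ (ρ + δ) ^ (n + 1) := by
  induction n with
  | zero => simp [hρ]
  | succ n ih =>
    have h1 : ρ ^ (n + 1) ≤ (ρ + δ) ^ (n + 1) := by gcongr; linarith
    push_cast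
    calc _ = ρ * (((n : ℝ) + 1) * ρ ^ n * δ) + ρ ^ (n + 1) * δ := by ring
      _ ≤ ρ * (ρ + δ) ^ (n + 1) + (ρ + δ) ^ (n + 1) * δ := by gcongr
      _ = _ := by ring

/-- The Lipschitz constant is the differentiated majorant series, which converges at any radius
strictly inside one where the series itself does. -/
lemma exists_lipschitz_superpose {ρ' : ℝ} (h0 : 0 ≤ ρ) (hρ' : ρ < ρ')
    (hs : Summable fun n => |a (n + 1)| * ρ' ^ (n + 1)) :
    ∃ L : ℝ, ∀ f g : C(Torus d, ℂ), ‖f‖ ≤ ρ → ‖g‖ ≤ ρ →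
      ‖superpose a f - superpose a g‖ ≤ L * ‖f - g‖ := by
  have hδ : 0 < ρ' - ρ := sub_pos.2 hρ'
  have hs' : Summable fun n => |a (n + 1)| * ρ ^ (n + 1) :=
    hs.of_nonneg_of_le (fun n => by positivity) fun n => by gcongr
  have hL : Summable fun n : ℕ => |a (n + 1)| * (((n : ℝ) + 1) * ρ ^ n) := by
    refine (hs.mul_right (ρ' - ρ)⁻¹).of_nonneg_of_le (fun n => by positivity) fun n => ?_
    have := succ_mul_pow_mul_le h0 hδ.le n
    rw [add_sub_cancel] at this
    rw [mul_assoc]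
    refine mul_le_mul_of_nonneg_left ?_ (abs_nonneg _)
    rwa [← div_eq_mul_inv, le_div_iff₀ hδ]
  refine ⟨∑' n : ℕ, |a (n + 1)| * (((n : ℝ) + 1) * ρ ^ n), fun f g hf hg => ?_⟩
  have h := (hasSum_superpose hs' hf).sub (hasSum_superpose hs' hg)
  rw [← h.tsum_eq]
  refine tsum_of_norm_bounded (hL.hasSum.mul_right _) fun n => ?_
  rw [← smul_sub, norm_smul, Complex.norm_real, Real.norm_eq_abs, mul_assoc]
  gcongr
  exact norm_pow_sub_pow_le hf hg n

end Composition

/-! ### Weighted coefficient bounds for powers and superpositions -/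

section CoefficientBounds

lemma enorm_ofReal (x : ℝ) : ‖(x : ℂ)‖ₑ = ‖x‖ₑ := by
  rw [← ofReal_norm, Complex.norm_real, ofReal_norm]

variable {d : ℕ}

/-- The exponential weight `exp(β|k|)`. -/
def expWeight (β : ℝ) (k : Fin d → ℤ) : ℝ≥0∞ := ENNReal.ofReal (Real.exp (β * freqNorm k))

lemma expWeight_zero_right (β : ℝ) : expWeight β (0 : Fin d → ℤ) = 1 := by
  simp [expWeight, freqNorm_zero]

lemma expWeight_le_mul {β : ℝ} (hβ : 0 ≤ β) (k l : Fin d → ℤ) :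
    expWeight β k ≤ expWeight β l * expWeight β (k - l) := by
  rw [expWeight, expWeight, expWeight, ← ENNReal.ofReal_mul (Real.exp_nonneg _), ← Real.exp_add,
    ← mul_add]
  gcongr
  exact freqNorm_le_add k l

lemma one_le_expWeight {β : ℝ} (hβ : 0 ≤ β) (k : Fin d → ℤ) : 1 ≤ expWeight β k := by
  rw [expWeight, ENNReal.one_le_ofReal]
  exact Real.one_le_exp (mul_nonneg hβ (freqNorm_nonneg k))

lemma expWeight_ne_top (β : ℝ) (k : Fin d → ℤ) : expWeight β k ≠ ∞ := ENNReal.ofReal_ne_top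

lemma expWeight_mono {β β' : ℝ} (h : β ≤ β') (k : Fin d → ℤ) : expWeight β k ≤ expWeight β' k := by
  have := freqNorm_nonneg k
  unfold expWeight
  gcongr

/-- The exponential weight is submultiplicative by the triangle inequality for frequencies, so it
distributes over the factors of a product. -/
lemma expWeight_mul_coeff_mul_le {β : ℝ} (hβ : 0 ≤ β) {c : (Fin d → ℤ) → ℂ}
    (hc : Summable fun k => ‖c k‖) (g : C(Torus d, ℂ)) (k : Fin d → ℤ) :
    expWeight β k * ‖coeffCLM k (fourierSum c * g)‖ₑ ≤
      conv (fun l => expWeight β l * ‖c l‖ₑ) (fun l => expWeight β l * ‖coeffCLM l g‖ₑ) k := by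
  rw [← (coeff_fourierSum_mul hc g k).tsum_eq]
  calc _ ≤ expWeight β k * ∑' l, ‖c l * coeffCLM (k - l) g‖ₑ := by
        gcongr
        exact enorm_tsum_le_tsum_enorm
    _ = ∑' l, expWeight β k * (‖c l‖ₑ * ‖coeffCLM (k - l) g‖ₑ) := by
        rw [← ENNReal.tsum_mul_left]
        simp only [enorm_mul]
    _ ≤ _ := ENNReal.tsum_le_tsum fun l => by
        calc _ ≤ expWeight β l * expWeight β (k - l) * (‖c l‖ₑ * ‖coeffCLM (k - l) g‖ₑ) := by
              gcongr
              exact expWeight_le_mul hβ k l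
          _ = _ := by ring

lemma summable_of_expWeight_mul_le {β : ℝ} (hβ : 0 ≤ β) {c : (Fin d → ℤ) → ℂ}
    {V : (Fin d → ℤ) → ℝ≥0∞} (hV : ∑' k, V k ≠ ∞) (h : ∀ k, expWeight β k * ‖c k‖ₑ ≤ V k) :
    Summable fun k => ‖c k‖ := by
  refine summable_of_tsum_enorm (ne_top_of_le_ne_top hV (ENNReal.tsum_le_tsum fun k => ?_))
  exact (le_mul_of_one_le_left zero_le (one_le_expWeight hβ k)).trans (h k)

lemma expWeight_mul_coeff_pow_le {β : ℝ} (hβ : 0 ≤ β) {c : (Fin d → ℤ) → ℂ}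
    {V : (Fin d → ℤ) → ℝ≥0∞} (hV : ∑' k, V k ≠ ∞) (h : ∀ k, expWeight β k * ‖c k‖ₑ ≤ V k) (n : ℕ)
    (k : Fin d → ℤ) : expWeight β k * ‖coeffCLM k (fourierSum c ^ n)‖ₑ ≤ convPow V n k := by
  classical
  induction n generalizing k with
  | zero =>
    rw [pow_zero, ← character_zero, coeff_character]
    by_cases hk : k = 0
    · subst hk
      simp [convPow, expWeight_zero_right]
    · simp [hk]
  | succ n ih =>
    rw [pow_succ']
    exact (expWeight_mul_coeff_mul_le hβ (summable_of_expWeight_mul_le hβ hV h) _ k).trans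
      (conv_mono h ih k)

/-- If the increment from `c` to `c'` is dominated by that from `V` to `V'`, the same holds for
powers: all terms of the telescoped difference are nonnegative on the majorant side. Writing it as a
sum avoids truncated subtraction and survives convolution. -/
lemma expWeight_mul_coeff_pow_sub_le {β : ℝ} (hβ : 0 ≤ β) {c c' : (Fin d → ℤ) → ℂ}
    {V V' : (Fin d → ℤ) → ℝ≥0∞} (hV' : ∑' k, V' k ≠ ∞)
    (h : ∀ k, expWeight β k * ‖c k‖ₑ ≤ V k) (h' : ∀ k, expWeight β k * ‖c' k‖ₑ ≤ V' k)
    (hd : ∀ k, expWeight β k * ‖c' k - c k‖ₑ + V k ≤ V' k) (n : ℕ) (k : Fin d → ℤ) :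
    expWeight β k * ‖coeffCLM k (fourierSum c' ^ n) - coeffCLM k (fourierSum c ^ n)‖ₑ +
      convPow V n k ≤ convPow V' n k := by
  have hVV' : V ≤ V' := fun k => le_add_self.trans (hd k)
  have hV : ∑' k, V k ≠ ∞ := ne_top_of_le_ne_top hV' (ENNReal.tsum_le_tsum hVV')
  have hc := summable_of_expWeight_mul_le hβ hV h
  have hc' := summable_of_expWeight_mul_le hβ hV' h'
  have hdc : Summable fun k => ‖(c' - c) k‖ := summable_of_expWeight_mul_le hβ hV'
    fun k => le_self_add.trans (hd k)
  induction n generalizing k with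
  | zero => simp [convPow]
  | succ n ih =>
    set D : (Fin d → ℤ) → ℝ≥0∞ := fun k => expWeight β k * ‖c' k - c k‖ₑ with hD
    set Dn : (Fin d → ℤ) → ℝ≥0∞ := fun k => expWeight β k *
      ‖coeffCLM k (fourierSum c' ^ n - fourierSum c ^ n)‖ₑ with hDn
    have hsplit : fourierSum c' ^ (n + 1) - fourierSum c ^ (n + 1) =
        fourierSum (c' - c) * fourierSum c' ^ n +
          fourierSum c * (fourierSum c' ^ n - fourierSum c ^ n) := by
      rw [fourierSum_sub hc' hc]
      ring
    rw [← map_sub, hsplit, map_add]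
    have h1 := (expWeight_mul_coeff_mul_le hβ hdc (fourierSum c' ^ n) k).trans
      (conv_mono (A' := D) (B' := convPow V' n) le_rfl
        (expWeight_mul_coeff_pow_le hβ hV' h' n) k)
    have h2 := (expWeight_mul_coeff_mul_le hβ hc (fourierSum c' ^ n - fourierSum c ^ n) k).trans
      (conv_mono (A' := V) (B' := Dn) h le_rfl k)
    calc _ ≤ (conv D (convPow V' n) k + conv V Dn k) + conv V (convPow V n) k := by
          gcongr
          · refine (mul_le_mul' le_rfl (enorm_add_le _ _)).trans ?_
            rw [mul_add]
            exact add_le_add h1 h2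
          · exact le_rfl
      _ = conv D (convPow V' n) k + conv V (Dn + convPow V n) k := by
          rw [conv_add, Pi.add_apply, add_assoc]
      _ ≤ conv D (convPow V' n) k + conv V (convPow V' n) k := by
          gcongr
          refine conv_mono le_rfl (fun l => ?_) k
          simpa only [Pi.add_apply, hDn, map_sub] using ih l
      _ = conv (D + V) (convPow V' n) k := by rw [add_conv, Pi.add_apply]
      _ ≤ _ := conv_mono hd le_rfl k

variable {a : ℕ → ℝ} {ρ : ℝ}

lemma norm_fourierSum_le {β : ℝ} (hβ : 0 ≤ β) {c : (Fin d → ℤ) → ℂ} (h0 : 0 ≤ ρ)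
    {V : (Fin d → ℤ) → ℝ≥0∞} (hV : ∑' k, V k ≤ ENNReal.ofReal ρ)
    (h : ∀ k, expWeight β k * ‖c k‖ₑ ≤ V k) : ‖fourierSum c‖ ≤ ρ := by
  have h1 : ‖fourierSum c‖ₑ ≤ ENNReal.ofReal ρ :=
    enorm_fourierSum_le.trans ((ENNReal.tsum_le_tsum fun k =>
      (le_mul_of_one_le_left zero_le (one_le_expWeight hβ k)).trans (h k)).trans hV)
  rwa [← ofReal_norm, ENNReal.ofReal_le_ofReal_iff h0] at h1

lemma expWeight_mul_coeff_superpose_le {β : ℝ} (hβ : 0 ≤ β) {c : (Fin d → ℤ) → ℂ} (h0 : 0 ≤ ρ)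
    (hρ : Summable fun n => |a (n + 1)| * ρ ^ (n + 1))
    {V : (Fin d → ℤ) → ℝ≥0∞} (hV : ∑' k, V k ≤ ENNReal.ofReal ρ)
    (h : ∀ k, expWeight β k * ‖c k‖ₑ ≤ V k) (k : Fin d → ℤ) :
    expWeight β k * ‖coeffCLM k (superpose a (fourierSum c))‖ₑ ≤
      majorant (fun n => ‖a n‖ₑ) V k := by
  have hs := (hasSum_superpose hρ (norm_fourierSum_le hβ h0 hV h)).mapL (coeffCLM k)
  rw [← hs.tsum_eq]
  refine (mul_le_mul' le_rfl enorm_tsum_le_tsum_enorm).trans ?_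
  rw [← ENNReal.tsum_mul_left]
  refine ENNReal.tsum_le_tsum fun n => ?_
  have h1 := expWeight_mul_coeff_pow_le hβ (ne_top_of_le_ne_top ENNReal.ofReal_ne_top hV) h
    (n + 1) k
  rw [map_smul, smul_eq_mul, enorm_mul, enorm_ofReal]
  calc _ = ‖a (n + 1)‖ₑ * (expWeight β k * ‖coeffCLM k (fourierSum c ^ (n + 1))‖ₑ) := by ring
    _ ≤ _ := by gcongr

lemma expWeight_mul_coeff_superpose_sub_le {β : ℝ} (hβ : 0 ≤ β) {c c' : (Fin d → ℤ) → ℂ}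
    (h0 : 0 ≤ ρ) (hρ : Summable fun n => |a (n + 1)| * ρ ^ (n + 1))
    {V V' : (Fin d → ℤ) → ℝ≥0∞} (hV' : ∑' k, V' k ≤ ENNReal.ofReal ρ)
    (h : ∀ k, expWeight β k * ‖c k‖ₑ ≤ V k) (h' : ∀ k, expWeight β k * ‖c' k‖ₑ ≤ V' k)
    (hd : ∀ k, expWeight β k * ‖c' k - c k‖ₑ + V k ≤ V' k) (k : Fin d → ℤ) :
    expWeight β k * ‖coeffCLM k (superpose a (fourierSum c')) -
        coeffCLM k (superpose a (fourierSum c))‖ₑ + majorant (fun n => ‖a n‖ₑ) V k ≤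
      majorant (fun n => ‖a n‖ₑ) V' k := by
  have hV : ∑' k, V k ≤ ENNReal.ofReal ρ :=
    (ENNReal.tsum_le_tsum fun k => le_add_self.trans (hd k)).trans hV'
  have hs := ((hasSum_superpose hρ (norm_fourierSum_le hβ h0 hV' h')).mapL (coeffCLM k)).sub
    ((hasSum_superpose hρ (norm_fourierSum_le hβ h0 hV h)).mapL (coeffCLM k))
  rw [← hs.tsum_eq]
  refine (add_le_add (mul_le_mul' le_rfl enorm_tsum_le_tsum_enorm) le_rfl).trans ?_
  rw [← ENNReal.tsum_mul_left, majorant, ← ENNReal.tsum_add]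
  refine ENNReal.tsum_le_tsum fun n => ?_
  have h1 := expWeight_mul_coeff_pow_sub_le hβ (ne_top_of_le_ne_top ENNReal.ofReal_ne_top hV')
    h h' hd (n + 1) k
  rw [map_smul, map_smul, ← smul_sub, smul_eq_mul, enorm_mul, enorm_ofReal]
  calc _ = ‖a (n + 1)‖ₑ * (expWeight β k * ‖coeffCLM k (fourierSum c' ^ (n + 1)) -
          coeffCLM k (fourierSum c ^ (n + 1))‖ₑ + convPow V (n + 1) k) := by ring
    _ ≤ _ := by gcongr

/-- Finiteness is what later allows majorants to be subtracted and converted to real numbers. -/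
lemma majorant_ne_top (h0 : 0 ≤ ρ) (hρ : Summable fun n => |a (n + 1)| * ρ ^ (n + 1))
    {V : (Fin d → ℤ) → ℝ≥0∞} (hV : ∑' k, V k ≤ ENNReal.ofReal ρ) (k : Fin d → ℤ) :
    majorant (fun n => ‖a n‖ₑ) V k ≠ ∞ := by
  refine ne_top_of_le_ne_top hρ.tsum_ofReal_ne_top (ENNReal.tsum_le_tsum fun n => ?_)
  rw [ENNReal.ofReal_mul (abs_nonneg _), ENNReal.ofReal_pow h0, ← Real.norm_eq_abs, ofReal_norm]
  gcongr
  calc convPow V (n + 1) k ≤ ∑' l, convPow V (n + 1) l := ENNReal.le_tsum k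
    _ = (∑' l, V l) ^ (n + 1) := tsum_convPow V (n + 1)
    _ ≤ _ := by gcongr

end CoefficientBounds

/-! ### Integration along rays: recovering the lost derivative -/

section Primitive

open Metric

open Classical in
/-- A primitive of `g` on the disc of radius `R` vanishing at the centre, if there is one. -/
def primitiveOn (R : ℝ) (g : ℂ → ℂ) : ℂ → ℂ :=
  if h : ∃ P : ℂ → ℂ, P 0 = 0 ∧ ∀ z ∈ ball (0 : ℂ) R, HasDerivAt P (g z) z then h.choose else 0

lemma primitiveOn_spec {R : ℝ} {g : ℂ → ℂ} (hg : DifferentiableOn ℂ g (ball 0 R)) :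
    primitiveOn R g 0 = 0 ∧ ∀ z ∈ ball (0 : ℂ) R, HasDerivAt (primitiveOn R g) (g z) z := by
  have h : ∃ P : ℂ → ℂ, P 0 = 0 ∧ ∀ z ∈ ball (0 : ℂ) R, HasDerivAt P (g z) z :=
    hg.isExactOn_ball.with_val_at 0 0
  rw [primitiveOn, dif_pos h]
  exact h.choose_spec

/-- On the ray `s ↦ sζ` the derivative of `P` is bounded by that of an explicit exponential
vanishing at `s = 0`; the mean value inequality compares the two at `s = 1`. -/
lemma norm_primitive_le {P g : ℂ → ℂ} {b lam κ x R : ℝ} (hlam : 0 < lam) (hκ : 0 < κ)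
    (hP0 : P 0 = 0) (hP : ∀ z ∈ ball (0 : ℂ) R, HasDerivAt P (g z) z)
    (hg : ∀ z ∈ ball (0 : ℂ) R, ‖g z‖ ≤ x * Real.exp (-((b - lam * ‖z‖) * κ)))
    {ζ : ℂ} (hζ : ζ ∈ ball (0 : ℂ) R) :
    ‖P ζ‖ ≤ x * Real.exp (-(b * κ)) * (Real.exp (lam * ‖ζ‖ * κ) - 1) / (lam * κ) := by
  have hmem (s : ℝ) (hs : s ∈ Icc (0 : ℝ) 1) : (s : ℂ) * ζ ∈ ball (0 : ℂ) R := by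
    rw [mem_ball_zero_iff, norm_mul, Complex.norm_real, Real.norm_eq_abs, abs_of_nonneg hs.1]
    exact (mul_le_of_le_one_left (norm_nonneg _) hs.2).trans_lt (mem_ball_zero_iff.1 hζ)
  have hd (s : ℝ) (hs : s ∈ Icc (0 : ℝ) 1) :
      HasDerivAt (fun s : ℝ => P (s * ζ)) (g (s * ζ) * ζ) s := by
    have h1 : HasDerivAt (fun w : ℂ => w * ζ) ζ (s : ℂ) := by
      simpa using (hasDerivAt_id (s : ℂ)).mul_const ζ
    exact ((hP _ (hmem s hs)).comp (s : ℂ) h1).comp_ofReal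
  have hB (s : ℝ) : HasDerivAt (fun s : ℝ => x * Real.exp (-(b * κ)) *
      (Real.exp (lam * (s * ‖ζ‖) * κ) - 1) / (lam * κ))
      (x * Real.exp (-(b * κ)) * Real.exp (lam * (s * ‖ζ‖) * κ) * ‖ζ‖) s := by
    have h1 : HasDerivAt (fun s : ℝ => lam * (s * ‖ζ‖) * κ) (lam * ‖ζ‖ * κ) s := by
      simpa using (((hasDerivAt_id s).mul_const ‖ζ‖).const_mul lam).mul_const κ
    convert! ((h1.exp.sub_const 1).const_mul (x * Real.exp (-(b * κ)))).div_const (lam * κ) using 1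
    field_simp
  have h := image_norm_le_of_norm_deriv_right_le_deriv_boundary (a := 0) (b := 1)
    (f := fun s : ℝ => P (s * ζ)) (fun s hs => (hd s hs).continuousAt.continuousWithinAt)
    (fun s hs => (hd s (Ico_subset_Icc_self hs)).hasDerivWithinAt) (by simp [hP0]) hB
    (fun s hs => ?_) (right_mem_Icc.2 zero_le_one)
  · simpa using h
  · have h2 := hg _ (hmem s (Ico_subset_Icc_self hs))
    have h3 : ‖(s : ℂ) * ζ‖ = s * ‖ζ‖ := by
      rw [norm_mul, Complex.norm_real, Real.norm_eq_abs, abs_of_nonneg hs.1]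
    rw [norm_mul]
    refine mul_le_mul_of_nonneg_right (h2.trans (le_of_eq ?_)) (norm_nonneg _)
    rw [h3, mul_assoc x, ← Real.exp_add]
    congr 2
    ring

variable {d : ℕ}

/-- Integration along rays of a quantity bounded by a shrinking exponential weight gains the factor
`|k|⁻¹` which the multiplier loses. -/
lemma expWeight_mul_multiplier_primitive_le {m : (Fin d → ℤ) → ℂ} {b lam CT : ℝ} (hb : 0 < b)
    (hlam : 0 < lam) (hCT : 0 ≤ CT) (hm0 : m 0 = 0)
    (hm : ∀ k, k ≠ 0 → ‖m k‖ ≤ CT * freqNorm k) {k : Fin d → ℤ} {P g : ℂ → ℂ} {X : ℝ≥0∞}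
    (hX : X ≠ ∞) (hP0 : P 0 = 0) (hP : ∀ z ∈ ball (0 : ℂ) (b / lam), HasDerivAt P (g z) z)
    (hg : ∀ z ∈ ball (0 : ℂ) (b / lam), expWeight (b - lam * ‖z‖) k * ‖g z‖ₑ ≤ X)
    {ζ : ℂ} (hζ : ζ ∈ ball (0 : ℂ) (b / lam)) :
    expWeight (b - lam * ‖ζ‖) k * ‖m k * P ζ‖ₑ ≤
      smoothing b k * (ENNReal.ofReal (CT / lam) * X) := by
  by_cases hk : k = 0
  · subst hk
    simp [hm0]
  have hκ : 0 < freqNorm k := zero_lt_one.trans_le (one_le_freqNorm hk)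
  obtain ⟨x, hx0, rfl⟩ : ∃ x : ℝ, 0 ≤ x ∧ X = ENNReal.ofReal x :=
    ⟨X.toReal, ENNReal.toReal_nonneg, (ENNReal.ofReal_toReal hX).symm⟩
  have hg' (z : ℂ) (hz : z ∈ ball (0 : ℂ) (b / lam)) :
      ‖g z‖ ≤ x * Real.exp (-((b - lam * ‖z‖) * freqNorm k)) := by
    have h := hg z hz
    rw [expWeight, ← ofReal_norm, ← ENNReal.ofReal_mul (Real.exp_nonneg _),
      ENNReal.ofReal_le_ofReal_iff hx0] at h
    rw [Real.exp_neg, ← div_eq_mul_inv, le_div_iff₀ (Real.exp_pos _), mul_comm]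
    exact h
  have h1 := norm_primitive_le hlam hκ hP0 hP hg' hζ
  have hζ' : lam * ‖ζ‖ ≤ b := by
    have := (mem_ball_zero_iff.1 hζ).le
    rwa [le_div_iff₀ hlam, mul_comm] at this
  rw [expWeight, smoothing, ← ofReal_norm, ← ENNReal.ofReal_mul (Real.exp_nonneg _),
    ← ENNReal.ofReal_mul (by positivity), ← ENNReal.ofReal_mul
      (sub_nonneg.2 (exp_neg_mul_freqNorm_le_one hb.le k)), norm_mul]
  refine ENNReal.ofReal_le_ofReal ?_
  set e := Real.exp (lam * ‖ζ‖ * freqNorm k) with he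
  have he1 : 1 ≤ e := Real.one_le_exp (by positivity)
  have h2 : Real.exp ((b - lam * ‖ζ‖) * freqNorm k) = Real.exp (b * freqNorm k) / e := by
    rw [he, ← Real.exp_sub]
    ring_nf
  -- This is where the disc enters: `lam|ζ| ≤ b` turns the computed factor `1 - 1/e` into the
  -- `ζ`-independent `1 - exp(-b|k|)`.
  have h3 : e ≤ Real.exp (b * freqNorm k) := by
    rw [he]
    gcongr
  calc Real.exp ((b - lam * ‖ζ‖) * freqNorm k) * (‖m k‖ * ‖P ζ‖)
      ≤ Real.exp ((b - lam * ‖ζ‖) * freqNorm k) * ((CT * freqNorm k) *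
        (x * Real.exp (-(b * freqNorm k)) * (e - 1) / (lam * freqNorm k))) := by
        gcongr
        exact hm k hk
    _ = (CT / lam * x) * (1 - 1 / e) := by
        rw [h2, Real.exp_neg]
        field_simp
    _ ≤ (CT / lam * x) * (1 - Real.exp (-(b * freqNorm k))) := by
        rw [Real.exp_neg, ← one_div]
        gcongr
    _ = _ := by ring

end Primitive

/-! ### Successive approximations and their limit -/

section Picard

open Metric

variable {d : ℕ}

/-- Fourier coefficients of the successive approximations to `du/dζ = T F(u)`. -/
def picardIter (m : (Fin d → ℤ) → ℂ) (a : ℕ → ℝ) (c₀ : (Fin d → ℤ) → ℂ) (R : ℝ) :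
    ℕ → ℂ → (Fin d → ℤ) → ℂ
  | 0 => 0
  | j + 1 => fun ζ k => c₀ k + m k * primitiveOn R
      (fun z => coeffCLM k (superpose a (fourierSum (picardIter m a c₀ R j z)))) ζ

/-- The hypotheses under which the successive approximations are controlled by the majorants. -/
structure PicardSetting (m : (Fin d → ℤ) → ℂ) (a : ℕ → ℝ) (c₀ : (Fin d → ℤ) → ℂ)
    (b lam CT ρ : ℝ) (V : ℕ → (Fin d → ℤ) → ℝ≥0∞) (W : (Fin d → ℤ) → ℝ≥0∞) : Prop where
  b_pos : 0 < b
  lam_pos : 0 < lam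
  CT_nonneg : 0 ≤ CT
  symbol_zero : m 0 = 0
  symbol_le : ∀ k, k ≠ 0 → ‖m k‖ ≤ CT * freqNorm k
  rho_nonneg : 0 ≤ ρ
  summable : Summable fun n => |a (n + 1)| * ρ ^ (n + 1)
  iter_eq : V = majorantIter b (ENNReal.ofReal (CT / lam)) (fun n => ‖a n‖ₑ)
    (fun k => expWeight (2 * b) k * ‖c₀ k‖ₑ)
  limit_eq : W = majorantLimit b (ENNReal.ofReal (CT / lam)) (fun n => ‖a n‖ₑ)
    (fun k => expWeight (2 * b) k * ‖c₀ k‖ₑ)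
  tsum_le : ∑' k, W k ≤ ENNReal.ofReal ρ

namespace PicardSetting

variable {m : (Fin d → ℤ) → ℂ} {a : ℕ → ℝ} {c₀ : (Fin d → ℤ) → ℂ} {b lam CT ρ : ℝ}
  {V : ℕ → (Fin d → ℤ) → ℝ≥0∞} {W : (Fin d → ℤ) → ℝ≥0∞}

lemma iter_zero (h : PicardSetting m a c₀ b lam CT ρ V W) : V 0 = 0 := by
  rw [h.iter_eq]
  rfl

lemma iter_succ (h : PicardSetting m a c₀ b lam CT ρ V W) (j : ℕ) (k : Fin d → ℤ) :
    V (j + 1) k = damping b k * (expWeight (2 * b) k * ‖c₀ k‖ₑ) +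
      smoothing b k * (ENNReal.ofReal (CT / lam) * majorant (fun n => ‖a n‖ₑ) (V j) k) := by
  rw [h.iter_eq]
  rfl

lemma iter_le_limit (h : PicardSetting m a c₀ b lam CT ρ V W) (j : ℕ) : V j ≤ W := by
  rw [h.iter_eq, h.limit_eq]
  exact le_majorantLimit j

lemma tendsto_iter (h : PicardSetting m a c₀ b lam CT ρ V W) (k : Fin d → ℤ) :
    Tendsto (fun j => V j k) atTop (𝓝 (W k)) := by
  rw [h.iter_eq, h.limit_eq]
  exact tendsto_majorantIter k

lemma tendsto_tsum_iter (h : PicardSetting m a c₀ b lam CT ρ V W) :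
    Tendsto (fun j => ∑' k, V j k) atTop (𝓝 (∑' k, W k)) := by
  rw [h.iter_eq, h.limit_eq]
  exact tendsto_tsum_majorantIter

lemma tsum_iter_le (h : PicardSetting m a c₀ b lam CT ρ V W) (j : ℕ) :
    ∑' k, V j k ≤ ENNReal.ofReal ρ :=
  (ENNReal.tsum_le_tsum (h.iter_le_limit j)).trans h.tsum_le

lemma limit_ne_top (h : PicardSetting m a c₀ b lam CT ρ V W) (k : Fin d → ℤ) : W k ≠ ∞ :=
  ne_top_of_le_ne_top ENNReal.ofReal_ne_top ((ENNReal.le_tsum k).trans h.tsum_le)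

lemma exponent_pos (h : PicardSetting m a c₀ b lam CT ρ V W) {ζ : ℂ}
    (hζ : ζ ∈ ball (0 : ℂ) (b / lam)) : 0 < b - lam * ‖ζ‖ := by
  have := mem_ball_zero_iff.1 hζ
  rw [lt_div_iff₀ h.lam_pos] at this
  linarith

/-- Only half of the initial radius `2b` is used by the solution; the unused half becomes the
damping factor that makes the recursion a convex combination. -/
lemma expWeight_mul_initial_le (h : PicardSetting m a c₀ b lam CT ρ V W) (ζ : ℂ)
    (k : Fin d → ℤ) : expWeight (b - lam * ‖ζ‖) k * ‖c₀ k‖ₑ ≤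
      damping b k * (expWeight (2 * b) k * ‖c₀ k‖ₑ) := by
  have h1 : damping b k * expWeight (2 * b) k = expWeight b k := by
    rw [damping, expWeight, expWeight, ← ENNReal.ofReal_mul (Real.exp_nonneg _), ← Real.exp_add]
    ring_nf
  rw [← mul_assoc, h1]
  refine mul_le_mul' (expWeight_mono ?_ k) le_rfl
  have := mul_nonneg h.lam_pos.le (norm_nonneg ζ)
  linarith

/-- Holomorphy of a family of Fourier series with holomorphic, summably bounded coefficients. -/
lemma differentiableOn_fourierSum {U : Set ℂ} (hU : IsOpen U) {c : ℂ → (Fin d → ℤ) → ℂ}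
    {W : (Fin d → ℤ) → ℝ≥0∞} (hW : ∑' k, W k ≠ ∞)
    (hd : ∀ k, DifferentiableOn ℂ (fun z => c z k) U) (hc : ∀ z ∈ U, ∀ k, ‖c z k‖ₑ ≤ W k) :
    DifferentiableOn ℂ (fun z => fourierSum (c z)) U := by
  refine Complex.differentiableOn_tsum_of_summable_norm (ENNReal.summable_toReal hW)
    (fun k => (hd k).smul_const _) hU fun k z hz => (norm_smul_character_le _ _).trans ?_
  rw [← toReal_enorm]
  exact ENNReal.toReal_mono (ne_top_of_le_ne_top hW (ENNReal.le_tsum k)) (hc z hz k)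

lemma enorm_le_of_expWeight_mul_le {β : ℝ} (hβ : 0 ≤ β) {k : Fin d → ℤ} {z : ℂ} {X : ℝ≥0∞}
    (h : expWeight β k * ‖z‖ₑ ≤ X) : ‖z‖ₑ ≤ X :=
  (le_mul_of_one_le_left zero_le (one_le_expWeight hβ k)).trans h

/-- A family of coefficients which is holomorphic and controlled by `W` on the disc. -/
def Controlled (b lam : ℝ) (W : (Fin d → ℤ) → ℝ≥0∞) (c : ℂ → (Fin d → ℤ) → ℂ) : Prop :=
  (∀ k, DifferentiableOn ℂ (fun z => c z k) (ball 0 (b / lam))) ∧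
    ∀ z ∈ ball (0 : ℂ) (b / lam), ∀ k, expWeight (b - lam * ‖z‖) k * ‖c z k‖ₑ ≤ W k

lemma Controlled.mono {W' : (Fin d → ℤ) → ℝ≥0∞} {c : ℂ → (Fin d → ℤ) → ℂ}
    (hc : Controlled b lam W' c) (hW : W' ≤ W) : Controlled b lam W c :=
  ⟨hc.1, fun z hz k => (hc.2 z hz k).trans (hW k)⟩

lemma norm_fourierSum_le (h : PicardSetting m a c₀ b lam CT ρ V W) {c : ℂ → (Fin d → ℤ) → ℂ}
    (hc : Controlled b lam W c) {z : ℂ} (hz : z ∈ ball (0 : ℂ) (b / lam)) :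
    ‖fourierSum (c z)‖ ≤ ρ :=
  GevreyAnalytic.norm_fourierSum_le (h.exponent_pos hz).le h.rho_nonneg h.tsum_le (hc.2 z hz)

lemma differentiableOn_fourierSum_controlled (h : PicardSetting m a c₀ b lam CT ρ V W)
    {c : ℂ → (Fin d → ℤ) → ℂ} (hc : Controlled b lam W c) :
    DifferentiableOn ℂ (fun z => fourierSum (c z)) (ball 0 (b / lam)) :=
  differentiableOn_fourierSum isOpen_ball
    (ne_top_of_le_ne_top ENNReal.ofReal_ne_top h.tsum_le) hc.1
    fun z hz k => enorm_le_of_expWeight_mul_le (h.exponent_pos hz).le (hc.2 z hz k)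

lemma differentiableOn_coeff_superpose (h : PicardSetting m a c₀ b lam CT ρ V W)
    {c : ℂ → (Fin d → ℤ) → ℂ} (hc : Controlled b lam W c) (k : Fin d → ℤ) :
    DifferentiableOn ℂ (fun z => coeffCLM k (superpose a (fourierSum (c z))))
      (ball 0 (b / lam)) :=
  (coeffCLM k).differentiable.comp_differentiableOn (differentiableOn_superpose h.summable
    isOpen_ball (h.differentiableOn_fourierSum_controlled hc) fun _ hz => h.norm_fourierSum_le hc hz)

/-- The recursion for `V` mirrors the integral equation term by term: damping bounds the initial
datum, and smoothing bounds the multiplier applied to the primitive. -/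
lemma controlled_picardIter (h : PicardSetting m a c₀ b lam CT ρ V W) (j : ℕ) :
    Controlled b lam (V j) (picardIter m a c₀ (b / lam) j) := by
  induction j with
  | zero => exact ⟨fun k => differentiableOn_const 0, fun z _ k => by simp [picardIter]⟩
  | succ j ih =>
    have hP (k : Fin d → ℤ) := primitiveOn_spec
      (h.differentiableOn_coeff_superpose (ih.mono (h.iter_le_limit j)) k)
    refine ⟨fun k z hz => ?_, fun z hz k => ?_⟩
    · exact (((hP k).2 z hz).const_mul (m k)).const_add (c₀ k)
        |>.differentiableAt.differentiableWithinAt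
    · rw [h.iter_succ]
      refine (mul_le_mul' le_rfl (enorm_add_le _ _)).trans ?_
      rw [mul_add]
      refine add_le_add (h.expWeight_mul_initial_le z k) ?_
      refine expWeight_mul_multiplier_primitive_le h.b_pos h.lam_pos h.CT_nonneg h.symbol_zero
        h.symbol_le (majorant_ne_top h.rho_nonneg h.summable (h.tsum_iter_le j) k) (hP k).1
        (hP k).2 (fun w hw => ?_) hz
      exact expWeight_mul_coeff_superpose_le (h.exponent_pos hw).le h.rho_nonneg h.summable
        (h.tsum_iter_le j) (ih.2 w hw) k

lemma hasDerivAt_picardIter_succ (h : PicardSetting m a c₀ b lam CT ρ V W) (j : ℕ)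
    (k : Fin d → ℤ) {z : ℂ} (hz : z ∈ ball (0 : ℂ) (b / lam)) :
    HasDerivAt (fun z => picardIter m a c₀ (b / lam) (j + 1) z k)
      (m k * coeffCLM k (superpose a (fourierSum (picardIter m a c₀ (b / lam) j z)))) z :=
  (((primitiveOn_spec (h.differentiableOn_coeff_superpose
    ((h.controlled_picardIter j).mono (h.iter_le_limit j)) k)).2 z hz).const_mul
      (m k)).const_add (c₀ k)

lemma picardIter_succ_zero (h : PicardSetting m a c₀ b lam CT ρ V W) (j : ℕ) (k : Fin d → ℤ) :
    picardIter m a c₀ (b / lam) (j + 1) 0 k = c₀ k := by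
  simp only [picardIter]
  rw [(primitiveOn_spec (h.differentiableOn_coeff_superpose
    ((h.controlled_picardIter j).mono (h.iter_le_limit j)) k)).1, mul_zero, add_zero]

/-- This replaces a contraction estimate: increments of the iterates are dominated by increments of
an increasing, bounded sequence of majorants. -/
lemma picardIter_succ_sub_le (h : PicardSetting m a c₀ b lam CT ρ V W) (j : ℕ) {z : ℂ}
    (hz : z ∈ ball (0 : ℂ) (b / lam)) (k : Fin d → ℤ) :
    expWeight (b - lam * ‖z‖) k * ‖picardIter m a c₀ (b / lam) (j + 1) z k -
      picardIter m a c₀ (b / lam) j z k‖ₑ + V j k ≤ V (j + 1) k := by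
  induction j generalizing z k with
  | zero =>
    -- Both iterations start from zero, not from the initial datum, so the first increment is the
    -- first iterate and its bound is already known.
    rw [h.iter_zero]
    simpa [picardIter] using (h.controlled_picardIter 1).2 z hz k
  | succ j ih =>
    have hP (i : ℕ) := primitiveOn_spec (h.differentiableOn_coeff_superpose
      ((h.controlled_picardIter i).mono (h.iter_le_limit i)) k)
    have hX := majorant_ne_top h.rho_nonneg h.summable (h.tsum_iter_le j) k
    have hX' := majorant_ne_top h.rho_nonneg h.summable (h.tsum_iter_le (j + 1)) k
    have hsub (w : ℂ) (hw : w ∈ ball (0 : ℂ) (b / lam)) :=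
      expWeight_mul_coeff_superpose_sub_le (h.exponent_pos hw).le h.rho_nonneg h.summable
        (h.tsum_iter_le (j + 1)) ((h.controlled_picardIter j).2 w hw)
        ((h.controlled_picardIter (j + 1)).2 w hw) (fun k => ih hw k) k
    have hle := le_add_self.trans (hsub z hz)
    have hdiff : picardIter m a c₀ (b / lam) (j + 1 + 1) z k -
        picardIter m a c₀ (b / lam) (j + 1) z k = m k *
          (primitiveOn (b / lam) (fun z => coeffCLM k (superpose a
            (fourierSum (picardIter m a c₀ (b / lam) (j + 1) z)))) z -
          primitiveOn (b / lam) (fun z => coeffCLM k (superpose a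
            (fourierSum (picardIter m a c₀ (b / lam) j z)))) z) := by
      rw [picardIter.eq_2 m a c₀ (b / lam) (j + 1), picardIter.eq_2 m a c₀ (b / lam) j]
      ring
    rw [hdiff, h.iter_succ, h.iter_succ (j + 1)]
    -- The ray estimate is linear in the integrand, so it applies to the difference of two
    -- primitives with the difference of the two majorants as bound.
    have key := expWeight_mul_multiplier_primitive_le h.b_pos h.lam_pos h.CT_nonneg h.symbol_zero
      h.symbol_le (k := k) (ENNReal.sub_ne_top hX' (b := majorant (fun n => ‖a n‖ₑ) (V j) k))
      (P := fun z => primitiveOn (b / lam) (fun z => coeffCLM k (superpose a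
            (fourierSum (picardIter m a c₀ (b / lam) (j + 1) z)))) z -
          primitiveOn (b / lam) (fun z => coeffCLM k (superpose a
            (fourierSum (picardIter m a c₀ (b / lam) j z)))) z)
      (by simp only [(hP j).1, (hP (j + 1)).1, sub_zero])
      (fun w hw => ((hP (j + 1)).2 w hw).sub ((hP j).2 w hw))
      (fun w hw => ENNReal.le_sub_of_add_le_right hX (hsub w hw)) hz
    calc _ ≤ smoothing b k * (ENNReal.ofReal (CT / lam) *
            (majorant (fun n => ‖a n‖ₑ) (V (j + 1)) k - majorant (fun n => ‖a n‖ₑ) (V j) k)) +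
          (damping b k * (expWeight (2 * b) k * ‖c₀ k‖ₑ) +
            smoothing b k * (ENNReal.ofReal (CT / lam) * majorant (fun n => ‖a n‖ₑ) (V j) k)) := by
          gcongr
      _ = damping b k * (expWeight (2 * b) k * ‖c₀ k‖ₑ) + smoothing b k *
            (ENNReal.ofReal (CT / lam) * ((majorant (fun n => ‖a n‖ₑ) (V (j + 1)) k -
              majorant (fun n => ‖a n‖ₑ) (V j) k) + majorant (fun n => ‖a n‖ₑ) (V j) k)) := by
          ring
      _ = _ := by rw [tsub_add_cancel_of_le hle]

/-- The one-step bounds telescope; the exponential weight, being at least `1`, is dropped. -/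
lemma picardIter_sub_le (h : PicardSetting m a c₀ b lam CT ρ V W) {i j : ℕ} (hij : j ≤ i) {z : ℂ}
    (hz : z ∈ ball (0 : ℂ) (b / lam)) (k : Fin d → ℤ) :
    ‖picardIter m a c₀ (b / lam) i z k - picardIter m a c₀ (b / lam) j z k‖ₑ + V j k ≤ V i k := by
  induction i, hij using Nat.le_induction with
  | base => simp
  | succ i hij ih =>
    have h1 := h.picardIter_succ_sub_le i hz k
    have h2 := enorm_le_of_expWeight_mul_le (h.exponent_pos hz).le
      (le_refl (expWeight (b - lam * ‖z‖) k * ‖picardIter m a c₀ (b / lam) (i + 1) z k -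
        picardIter m a c₀ (b / lam) i z k‖ₑ))
    have h3 : picardIter m a c₀ (b / lam) (i + 1) z k - picardIter m a c₀ (b / lam) j z k =
        (picardIter m a c₀ (b / lam) (i + 1) z k - picardIter m a c₀ (b / lam) i z k) +
        (picardIter m a c₀ (b / lam) i z k - picardIter m a c₀ (b / lam) j z k) := by ring
    rw [h3]
    calc _ ≤ (‖picardIter m a c₀ (b / lam) (i + 1) z k - picardIter m a c₀ (b / lam) i z k‖ₑ +
          ‖picardIter m a c₀ (b / lam) i z k - picardIter m a c₀ (b / lam) j z k‖ₑ) + V j k := by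
          gcongr
          exact enorm_add_le _ _
      _ ≤ expWeight (b - lam * ‖z‖) k * ‖picardIter m a c₀ (b / lam) (i + 1) z k -
          picardIter m a c₀ (b / lam) i z k‖ₑ + V i k := by
          rw [add_assoc]
          exact add_le_add h2 ih
      _ ≤ _ := h1

/-- The successive approximations converge, coefficient by coefficient. -/
lemma exists_limit (h : PicardSetting m a c₀ b lam CT ρ V W) {z : ℂ}
    (hz : z ∈ ball (0 : ℂ) (b / lam)) (k : Fin d → ℤ) :
    ∃ c, Tendsto (fun j => picardIter m a c₀ (b / lam) j z k) atTop (𝓝 c) := by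
  have hV (j : ℕ) : V j k ≠ ∞ := ne_top_of_le_ne_top (h.limit_ne_top k) (h.iter_le_limit j k)
  refine cauchySeq_tendsto_of_complete (cauchySeq_of_le_tendsto_0'
    (fun j => (W k).toReal - (V j k).toReal) (fun j i hij => ?_) ?_)
  · have h1 := (h.picardIter_sub_le hij hz k).trans (h.iter_le_limit i k)
    have h2 := ENNReal.toReal_mono (h.limit_ne_top k) h1
    rw [ENNReal.toReal_add enorm_ne_top (hV j), toReal_enorm] at h2
    rw [dist_comm, dist_eq_norm]
    linarith
  · have h1 := (ENNReal.tendsto_toReal (h.limit_ne_top k)).comp (h.tendsto_iter k)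
    simpa using h1.const_sub (W k).toReal

open Classical in
/-- The limit of the successive approximations. -/
def picardLimit (h : PicardSetting m a c₀ b lam CT ρ V W) (z : ℂ) (k : Fin d → ℤ) : ℂ :=
  if hz : z ∈ ball (0 : ℂ) (b / lam) then (h.exists_limit hz k).choose else 0

lemma tendsto_picardLimit (h : PicardSetting m a c₀ b lam CT ρ V W) {z : ℂ}
    (hz : z ∈ ball (0 : ℂ) (b / lam)) (k : Fin d → ℤ) :
    Tendsto (fun j => picardIter m a c₀ (b / lam) j z k) atTop (𝓝 (h.picardLimit z k)) := by
  rw [picardLimit, dif_pos hz]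
  exact (h.exists_limit hz k).choose_spec

lemma picardLimit_sub_le (h : PicardSetting m a c₀ b lam CT ρ V W) (j : ℕ) {z : ℂ}
    (hz : z ∈ ball (0 : ℂ) (b / lam)) (k : Fin d → ℤ) :
    ‖h.picardLimit z k - picardIter m a c₀ (b / lam) j z k‖ₑ + V j k ≤ W k := by
  refine le_of_tendsto ((((h.tendsto_picardLimit hz k).sub_const _).enorm).add_const _) ?_
  filter_upwards [eventually_ge_atTop j] with i hi
  exact (h.picardIter_sub_le hi hz k).trans (h.iter_le_limit i k)

lemma expWeight_mul_picardLimit_le (h : PicardSetting m a c₀ b lam CT ρ V W) {z : ℂ}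
    (hz : z ∈ ball (0 : ℂ) (b / lam)) (k : Fin d → ℤ) :
    expWeight (b - lam * ‖z‖) k * ‖h.picardLimit z k‖ₑ ≤ W k :=
  le_of_tendsto' (ENNReal.Tendsto.const_mul (h.tendsto_picardLimit hz k).enorm
    (Or.inr (expWeight_ne_top _ _)))
    fun j => ((h.controlled_picardIter j).2 z hz k).trans (h.iter_le_limit j k)

/-- The error is at most `W k - V j k`, which does not depend on the point of the disc. -/
lemma tendstoUniformlyOn_picardIter (h : PicardSetting m a c₀ b lam CT ρ V W) (k : Fin d → ℤ) :
    TendstoUniformlyOn (fun j z => picardIter m a c₀ (b / lam) j z k)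
      (fun z => h.picardLimit z k) atTop (ball 0 (b / lam)) := by
  have hV (j : ℕ) : V j k ≠ ∞ := ne_top_of_le_ne_top (h.limit_ne_top k) (h.iter_le_limit j k)
  have h1 := (ENNReal.tendsto_toReal (h.limit_ne_top k)).comp (h.tendsto_iter k)
  rw [Metric.tendstoUniformlyOn_iff]
  intro ε hε
  filter_upwards [h1.eventually (lt_mem_nhds (sub_lt_self _ hε))] with j hj z hz
  have h2 := ENNReal.toReal_mono (h.limit_ne_top k) (h.picardLimit_sub_le j hz k)
  rw [ENNReal.toReal_add enorm_ne_top (hV j), toReal_enorm] at h2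
  rw [dist_eq_norm]
  simp only [Function.comp_apply] at hj
  linarith

lemma controlled_picardLimit (h : PicardSetting m a c₀ b lam CT ρ V W) :
    Controlled b lam W h.picardLimit :=
  ⟨fun k => (h.tendstoUniformlyOn_picardIter k).tendstoLocallyUniformlyOn.differentiableOn
    (Eventually.of_forall fun j => (h.controlled_picardIter j).1 k) isOpen_ball,
    fun _ hz k => h.expWeight_mul_picardLimit_le hz k⟩

lemma tendsto_fourierSum_picardIter (h : PicardSetting m a c₀ b lam CT ρ V W) {z : ℂ}
    (hz : z ∈ ball (0 : ℂ) (b / lam)) :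
    Tendsto (fun j => fourierSum (picardIter m a c₀ (b / lam) j z)) atTop
      (𝓝 (fourierSum (h.picardLimit z))) := by
  have hWtop : ∑' k, W k ≠ ∞ := ne_top_of_le_ne_top ENNReal.ofReal_ne_top h.tsum_le
  have hs {c : ℂ → (Fin d → ℤ) → ℂ} (hc : Controlled b lam W c) : Summable fun k => ‖c z k‖ :=
    summable_of_expWeight_mul_le (h.exponent_pos hz).le hWtop (hc.2 z hz)
  have hW1 (j : ℕ) : ∑' k, V j k ≠ ∞ :=
    ne_top_of_le_ne_top ENNReal.ofReal_ne_top (h.tsum_iter_le j)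
  rw [tendsto_iff_norm_sub_tendsto_zero]
  refine squeeze_zero (g := fun j => (∑' k, W k).toReal - (∑' k, V j k).toReal)
    (fun j => norm_nonneg _) (fun j => ?_) ?_
  · have h1 : ‖fourierSum (picardIter m a c₀ (b / lam) j z) - fourierSum (h.picardLimit z)‖ₑ +
        ∑' k, V j k ≤ ∑' k, W k := by
      rw [← enorm_neg, neg_sub, ← fourierSum_sub (hs h.controlled_picardLimit)
        (hs ((h.controlled_picardIter j).mono (h.iter_le_limit j)))]
      refine (add_le_add enorm_fourierSum_le le_rfl).trans ?_
      rw [← ENNReal.tsum_add]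
      exact ENNReal.tsum_le_tsum fun k => h.picardLimit_sub_le j hz k
    have h2 := ENNReal.toReal_mono hWtop h1
    rw [ENNReal.toReal_add enorm_ne_top (hW1 j), toReal_enorm] at h2
    linarith
  · have h1 := (ENNReal.tendsto_toReal hWtop).comp h.tendsto_tsum_iter
    simpa using h1.const_sub (∑' k, W k).toReal

/-- By Weierstrass, derivatives of uniformly convergent holomorphic functions converge. The iterates
also converge in the supremum norm, where superposition is continuous, so the right-hand sides
converge too. -/
lemma hasDerivAt_picardLimit (h : PicardSetting m a c₀ b lam CT ρ V W) {z : ℂ}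
    (hz : z ∈ ball (0 : ℂ) (b / lam)) (k : Fin d → ℤ) :
    HasDerivAt (fun z => h.picardLimit z k)
      (m k * coeffCLM k (superpose a (fourierSum (h.picardLimit z)))) z := by
  have h1 := ((h.tendstoUniformlyOn_picardIter k).tendstoLocallyUniformlyOn.deriv
    (Eventually.of_forall fun j => (h.controlled_picardIter j).1 k) isOpen_ball).tendsto_at hz
  have h1' := h1.comp (tendsto_add_atTop_nat 1)
  have h2 : Tendsto (fun j => m k * coeffCLM k (superpose a (fourierSum
      (picardIter m a c₀ (b / lam) j z)))) atTop
      (𝓝 (m k * coeffCLM k (superpose a (fourierSum (h.picardLimit z))))) := by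
    refine Tendsto.const_mul _ (((coeffCLM k).continuous.tendsto _).comp ?_)
    refine ((continuousOn_superpose h.summable) _
      (h.norm_fourierSum_le h.controlled_picardLimit hz)).tendsto.comp
      (tendsto_nhdsWithin_iff.2 ⟨h.tendsto_fourierSum_picardIter hz, Eventually.of_forall fun j =>
        h.norm_fourierSum_le ((h.controlled_picardIter j).mono (h.iter_le_limit j)) hz⟩)
  have h3 := tendsto_nhds_unique (h1'.congr fun j => (h.hasDerivAt_picardIter_succ j k hz).deriv) h2
  rw [← h3]
  exact ((h.controlled_picardLimit.1 k).differentiableAt (isOpen_ball.mem_nhds hz)).hasDerivAt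

lemma picardLimit_zero (h : PicardSetting m a c₀ b lam CT ρ V W) : h.picardLimit 0 = c₀ := by
  ext k
  have hz : (0 : ℂ) ∈ ball (0 : ℂ) (b / lam) := mem_ball_self (div_pos h.b_pos h.lam_pos)
  refine tendsto_nhds_unique ((h.tendsto_picardLimit hz k).comp (tendsto_add_atTop_nat 1)) ?_
  simp only [Function.comp_def, h.picardIter_succ_zero]
  exact tendsto_const_nhds

end PicardSetting

end Picard

/-! ### Holomorphy in Gevrey norms -/

section GevreyHolomorphy

open Metric

/-- The difference quotient of a bounded holomorphic function converges with a uniform rate. -/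
lemma norm_slope_sub_deriv_le {f : ℂ → ℂ} {ζ h : ℂ} {δ A : ℝ} (hf : DifferentiableOn ℂ f (ball ζ δ))
    (hA : ∀ z ∈ ball ζ δ, ‖f z‖ ≤ A) (hh : h ≠ 0) (hhδ : ‖h‖ < δ) :
    ‖h⁻¹ * (f (ζ + h) - f ζ) - deriv f ζ‖ ≤ 4 / δ ^ 2 * ‖h‖ * A := by
  have hδ : 0 < δ := (norm_nonneg h).trans_lt hhδ
  have hζ : ζ ∈ ball ζ δ := mem_ball_self hδ
  have hmem : ζ + h ∈ ball ζ δ := by simpa [mem_ball_iff_norm] using hhδ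
  have hne : ζ + h ≠ ζ := by simpa using hh
  -- The Schwarz lemma is applied twice, to `f` and then to its divided difference; the quotient
  -- error is `h` times the second divided difference.
  have h1 (z : ℂ) (hz : z ∈ ball ζ δ) : ‖dslope f ζ z‖ ≤ 2 * A / δ := by
    refine Complex.norm_dslope_le_div_of_mapsTo_ball hf (fun w hw => ?_) hz
    rw [mem_closedBall_iff_norm]
    linarith [norm_sub_le (f w) (f ζ), hA w hw, hA ζ hζ]
  have h2 : ‖dslope (dslope f ζ) ζ (ζ + h)‖ ≤ 2 * (2 * A / δ) / δ := by
    refine Complex.norm_dslope_le_div_of_mapsTo_ball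
      ((Complex.differentiableOn_dslope (ball_mem_nhds ζ hδ)).2 hf) (fun w hw => ?_) hmem
    rw [mem_closedBall_iff_norm]
    linarith [norm_sub_le (dslope f ζ w) (dslope f ζ ζ), h1 w hw, h1 ζ hζ]
  have h3 : h⁻¹ * (f (ζ + h) - f ζ) - deriv f ζ = h * dslope (dslope f ζ) ζ (ζ + h) := by
    rw [dslope_of_ne _ hne, slope_def_module, dslope_of_ne _ hne, slope_def_module, dslope_same]
    simp only [add_sub_cancel_left, smul_eq_mul]
    rw [mul_inv_cancel_left₀ hh]
  rw [h3, norm_mul]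
  calc _ ≤ ‖h‖ * (2 * (2 * A / δ) / δ) := by gcongr
    _ = _ := by field_simp; ring

variable {d : ℕ}

lemma gevreyNorm_le_of_coeff_le {r β : ℝ} {f : C(Torus d, ℂ)} {W : (Fin d → ℤ) → ℝ≥0∞}
    {κ : ℝ≥0∞} (h : ∀ k, expWeight β k * ‖coeffCLM k f‖ₑ ≤ κ * W k) :
    gevreyNorm r β f ≤ κ * l2 (sobolevWeight r * W) := by
  rw [gevreyNorm_eq, ← l2_smul]
  refine l2_mono fun k => ?_
  simp only [Pi.mul_apply, Pi.smul_apply, smul_eq_mul]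
  calc _ ≤ sobolevWeight r k * (κ * W k) := mul_le_mul' le_rfl (h k)
    _ = _ := by ring

/-- Each weighted coefficient is bounded by `W k` near the point, so its difference quotient
converges with an error `O(|h|) W k`, the constant being independent of `k`. The factor comes out of
the Gevrey norm, leaving the finite Sobolev norm of `W`. -/
lemma gevreyHolomorphicOn_of_controlled {r b lam : ℝ} (hlam : 0 < lam)
    {W : (Fin d → ℤ) → ℝ≥0∞} (hW : ∑' k, W k ≠ ∞)
    (hWr : l2 (sobolevWeight r * W) ≠ ∞) {c : ℂ → (Fin d → ℤ) → ℂ}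
    (hc : PicardSetting.Controlled b lam W c) {u : ℂ → C(Torus d, ℂ)}
    (hu : ∀ z ∈ ball (0 : ℂ) (b / lam), ∀ k, coeffCLM k (u z) = c z k)
    (hud : DifferentiableOn ℂ u (ball 0 (b / lam))) {R : Set ℂ} (hR : R ⊆ ball 0 (b / lam)) :
    GevreyHolomorphicOn r R u := by
  intro ζ₀ hζ₀
  have h0 := mem_ball_zero_iff.1 (hR hζ₀)
  -- One third of the distance to the boundary for moving `ζ`, one for the disc around `ζ` used by
  -- the Schwarz lemma, and one to keep `β` positive.
  set δ := (b / lam - ‖ζ₀‖) / 3 with hδdef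
  have hδ : 0 < δ := by linarith
  have hβ : 0 < b - lam * (‖ζ₀‖ + 2 * δ) := by
    have : ‖ζ₀‖ + 2 * δ < b / lam := by linarith
    rw [lt_div_iff₀ hlam] at this
    linarith
  set β := b - lam * (‖ζ₀‖ + 2 * δ) with hβdef
  have hsmall (z : ℂ) (hz : ‖z‖ < ‖ζ₀‖ + 2 * δ) : z ∈ ball (0 : ℂ) (b / lam) :=
    mem_ball_zero_iff.2 (by linarith)
  have hcoef (z : ℂ) (hz : ‖z‖ < ‖ζ₀‖ + 2 * δ) (k : Fin d → ℤ) :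
      expWeight β k * ‖c z k‖ₑ ≤ W k := by
    refine (mul_le_mul' (expWeight_mono ?_ k) le_rfl).trans (hc.2 z (hsmall z hz) k)
    have := mul_le_mul_of_nonneg_left hz.le hlam.le
    linarith
  refine ⟨β, hβ, ?_⟩
  filter_upwards [ball_mem_nhds ζ₀ hδ] with ζ hζ
  have hζn : ‖ζ‖ < ‖ζ₀‖ + δ := by
    have := norm_le_norm_add_norm_sub' ζ ζ₀
    rw [mem_ball_iff_norm] at hζ
    linarith
  have hball (z : ℂ) (hz : z ∈ ball ζ δ) : ‖z‖ < ‖ζ₀‖ + 2 * δ := by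
    have := norm_le_norm_add_norm_sub' z ζ
    rw [mem_ball_iff_norm] at hz
    linarith
  have hζb := hball ζ (mem_ball_self hδ)
  constructor
  · refine lt_of_le_of_lt (gevreyNorm_le_of_coeff_le (κ := 1) (W := W) fun k => ?_)
      (by rw [one_mul]; exact hWr.lt_top)
    rw [hu ζ (hsmall ζ hζb), one_mul]
    exact hcoef ζ hζb k
  · have hlim : Tendsto (fun h : ℂ => ENNReal.ofReal (4 / δ ^ 2 * ‖h‖) *
        l2 (sobolevWeight r * W)) (𝓝[≠] 0) (𝓝 0) := by
      have h1 : Tendsto (fun h : ℂ => 4 / δ ^ 2 * ‖h‖) (𝓝[≠] 0) (𝓝 0) := by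
        have : Continuous fun h : ℂ => 4 / δ ^ 2 * ‖h‖ := by fun_prop
        simpa using (this.tendsto 0).mono_left nhdsWithin_le_nhds
      simpa using ENNReal.Tendsto.mul_const (ENNReal.tendsto_ofReal h1) (Or.inr hWr)
    refine tendsto_of_tendsto_of_tendsto_of_le_of_le' tendsto_const_nhds hlim
      (Eventually.of_forall fun _ => zero_le) ?_
    filter_upwards [self_mem_nhdsWithin, nhdsWithin_le_nhds (ball_mem_nhds (0 : ℂ) hδ)]
      with h hh hhδ
    rw [mem_ball_zero_iff] at hhδ
    refine gevreyNorm_le_of_coeff_le fun k => ?_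
    have hWk : W k ≠ ∞ := ne_top_of_le_ne_top hW (ENNReal.le_tsum k)
    have hderiv : coeffCLM k (deriv u ζ) = deriv (fun z => c z k) ζ := by
      have h1 := (coeffCLM k).hasFDerivAt.comp_hasDerivAt ζ
        (hud.differentiableAt (isOpen_ball.mem_nhds (hsmall ζ hζb))).hasDerivAt
      refine (h1.congr_of_eventuallyEq ?_).deriv.symm
      filter_upwards [isOpen_ball.mem_nhds (hsmall ζ hζb)] with z hz
      exact (hu z hz k).symm
    have hζh : ζ + h ∈ ball ζ δ := by simpa [mem_ball_iff_norm] using hhδ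
    have hbound := norm_slope_sub_deriv_le (A := (W k).toReal * Real.exp (-(β * freqNorm k)))
      ((hc.1 k).mono fun z hz => hsmall z (hball z hz)) (fun z hz => ?_) hh hhδ
    · rw [map_sub, map_smul, map_sub, hu _ (hsmall _ (hball _ hζh)), hu ζ (hsmall ζ hζb), hderiv,
        smul_eq_mul, ← ENNReal.ofReal_toReal hWk, ← ofReal_norm, expWeight,
        ← ENNReal.ofReal_mul (Real.exp_nonneg _), ← ENNReal.ofReal_mul (by positivity)]
      refine ENNReal.ofReal_le_ofReal ?_
      calc _ ≤ Real.exp (β * freqNorm k) * (4 / δ ^ 2 * ‖h‖ *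
            ((W k).toReal * Real.exp (-(β * freqNorm k)))) := by gcongr
        _ = (Real.exp (β * freqNorm k) * Real.exp (-(β * freqNorm k))) *
            (4 / δ ^ 2 * ‖h‖ * (W k).toReal) := by ring
        _ = _ := by rw [← Real.exp_add, add_neg_cancel, Real.exp_zero, one_mul]
    · have h1 := ENNReal.toReal_mono hWk (hcoef z (hball z hz) k)
      rw [ENNReal.toReal_mul, toReal_enorm, expWeight,
        ENNReal.toReal_ofReal (Real.exp_nonneg _)] at h1
      rw [Real.exp_neg, ← div_eq_mul_inv, le_div_iff₀ (Real.exp_pos _), mul_comm]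
      exact h1

end GevreyHolomorphy

/-! ### Uniqueness -/

section Uniqueness

variable {d : ℕ} {m : (Fin d → ℤ) → ℂ} {a : ℕ → ℝ} {u₀ : Torus d → ℂ}

lemma exists_summable_of_lt_majorantRadius {x : ℝ} (h0 : 0 ≤ x)
    (hx : ENNReal.ofReal x < majorantRadius a) :
    ∃ s, x < s ∧ Summable fun n => |a (n + 1)| * s ^ (n + 1) := by
  simp only [majorantRadius, lt_iSup_iff] at hx
  obtain ⟨s, hs, hxs⟩ := hx
  refine ⟨s, ?_, ?_⟩
  · rwa [← ENNReal.ofReal_coe_nnreal, ENNReal.ofReal_lt_ofReal_iff_of_nonneg h0] at hxs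
  · have h := ENNReal.summable_toReal (ne_of_lt hs)
    refine ((summable_nat_add_iff 1).2 h).congr fun n => ?_
    simp

/-- Differentiability off `0` and continuity at `0` make the singularity removable. -/
lemma IsSolution.analyticAt {R S : Set ℂ} (hS : IsOpen S) (h0 : (0 : ℂ) ∈ S)
    (hR : R = S \ {0}) {u : ℂ → C(Torus d, ℂ)} (hu : IsSolution m a u₀ R u) : AnalyticOnNhd ℂ u S := by
  have hdiff : DifferentiableOn ℂ u (S \ {0}) := by
    rw [← hR]
    intro z hz
    obtain ⟨w, hw, -⟩ := hu.equation z hz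
    exact hw.differentiableAt.differentiableWithinAt
  have hcont : ContinuousAt u 0 := by
    rw [← continuousWithinAt_compl_self]
    refine hu.continuous_zero.mono_of_mem_nhdsWithin ?_
    rw [hR, sdiff_eq, inter_comm]
    exact inter_mem_nhdsWithin _ (hS.mem_nhds h0)
  exact ((Complex.differentiableOn_compl_singleton_and_continuousAt_iff
    (hS.mem_nhds h0)).1 ⟨hdiff, hcont⟩).analyticOnNhd hS

/-- If a holomorphic function `f` vanishes at `0` and each Fourier coefficient of `f'` is bounded
by a multiple of `‖f‖` near `0`, then `f` vanishes near `0`. -/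
lemma eventually_eq_zero_of_coeff_deriv_le {f : ℂ → C(Torus d, ℂ)} (hf : AnalyticAt ℂ f 0)
    (hf0 : f 0 = 0) {M : (Fin d → ℤ) → ℝ}
    (hM : ∀ k, ∀ᶠ z in 𝓝[≠] 0, ‖coeffCLM k (deriv f z)‖ ≤ M k * ‖f z‖) :
    ∀ᶠ z in 𝓝 0, f z = 0 := by
  by_contra hne
  -- Factor out the exact order of vanishing, positive because `f 0 = 0`. Then `f'` has order one
  -- less than `f`, which the assumed bound forbids coefficientwise.
  obtain ⟨n, g, hg, hg0, hfg⟩ := hf.exists_eventuallyEq_pow_smul_nonzero_iff.2 hne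
  simp only [sub_zero] at hfg
  obtain ⟨p, rfl⟩ : ∃ p, n = p + 1 := by
    cases n with
    | zero => exact absurd (by simpa [hf0] using hfg.self_of_nhds.symm) hg0
    | succ p => exact ⟨p, rfl⟩
  refine hg0 (eq_zero_of_coeff_eq_zero fun k => ?_)
  have hlim1 : Tendsto (fun z => ‖((p : ℂ) + 1) * coeffCLM k (g z) + z * coeffCLM k (deriv g z)‖)
      (𝓝[≠] 0) (𝓝 ‖((p : ℂ) + 1) * coeffCLM k (g 0)‖) := by
    have hc : ContinuousAt (fun z => ‖((p : ℂ) + 1) * coeffCLM k (g z) +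
        z * coeffCLM k (deriv g z)‖) 0 := by
      have h1 := ((coeffCLM k).continuous.continuousAt (x := g 0)).comp hg.continuousAt
      have h2 := ((coeffCLM k).continuous.continuousAt (x := deriv g 0)).comp hg.deriv.continuousAt
      exact ((continuousAt_const.mul h1).add (continuousAt_id.mul h2)).norm
    simpa using hc.tendsto.mono_left nhdsWithin_le_nhds
  have hlim2 : Tendsto (fun z => M k * (‖z‖ * ‖g z‖)) (𝓝[≠] 0) (𝓝 0) := by
    have hc : ContinuousAt (fun z => M k * (‖z‖ * ‖g z‖)) 0 :=
      continuousAt_const.mul (continuousAt_id.norm.mul hg.continuousAt.norm)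
    simpa using hc.tendsto.mono_left nhdsWithin_le_nhds
  have hle : ‖((p : ℂ) + 1) * coeffCLM k (g 0)‖ ≤ 0 := by
    refine le_of_tendsto_of_tendsto hlim1 hlim2 ?_
    filter_upwards [hM k, self_mem_nhdsWithin, nhdsWithin_le_nhds hfg.eventually_nhds,
      nhdsWithin_le_nhds hg.eventually_analyticAt] with z h1 hz h2 h3
    have hz' : z ≠ 0 := hz
    have hd : HasDerivAt (fun z => z ^ (p + 1) • g z)
        (z ^ (p + 1) • deriv g z + (((p + 1 : ℕ) : ℂ) * z ^ p) • g z) z := by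
      exact (hasDerivAt_pow (p + 1) z).fun_smul h3.differentiableAt.hasDerivAt
    have hder : deriv f z = z ^ (p + 1) • deriv g z + (((p + 1 : ℕ) : ℂ) * z ^ p) • g z := by
      rw [EventuallyEq.deriv_eq h2, hd.deriv]
    have hco : coeffCLM k (deriv f z) =
        z ^ p * (((p : ℂ) + 1) * coeffCLM k (g z) + z * coeffCLM k (deriv g z)) := by
      rw [hder, map_add, map_smul, map_smul, smul_eq_mul, smul_eq_mul]
      push_cast
      ring
    rw [hco, h2.self_of_nhds, norm_mul, norm_smul, norm_pow, norm_pow] at h1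
    have hpos : 0 < ‖z‖ ^ p := pow_pos (norm_pos_iff.2 hz') p
    -- Dividing by `|z|^p` leaves `(p + 1) ĝ(0)` on the left in the limit, while the right side
    -- still carries a factor `|z|`.
    refine le_of_mul_le_mul_left (h1.trans (le_of_eq ?_)) hpos
    ring
  have h0 := norm_le_zero_iff.1 hle
  exact (mul_eq_zero.1 h0).resolve_left (Nat.cast_add_one_ne_zero p)

/-- Near `0` both solutions stay in a ball where superposition is Lipschitz, so the `k`-th
coefficient of the derivative of their difference is at most `|m k| L` times the norm of the
difference. Dependence on `k` is harmless here. -/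
lemma IsSolution.eqOn (ha : a 0 = 0) {R S : Set ℂ} (hS : IsOpen S) (hSc : IsPreconnected S)
    (h0 : (0 : ℂ) ∈ S) (hR : R = S \ {0}) {u v : ℂ → C(Torus d, ℂ)} (hu : IsSolution m a u₀ R u)
    (hv : IsSolution m a u₀ R v) (hu0 : ‖u 0‖ₑ < majorantRadius a) : EqOn v u R := by
  have huv : v 0 = u 0 := DFunLike.coe_injective
    ((Continuous.ae_eq_iff_eq volume (v 0).continuous (u 0).continuous).1
      (hv.initial.trans hu.initial.symm))
  have hua := hu.analyticAt hS h0 hR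
  have hva := hv.analyticAt hS h0 hR
  obtain ⟨s, hs, hsum⟩ := exists_summable_of_lt_majorantRadius (norm_nonneg (u 0))
    (by rwa [ofReal_norm])
  obtain ⟨ρ, hρ1, hρ2⟩ := exists_between hs
  have hρ0 : 0 ≤ ρ := (norm_nonneg _).trans hρ1.le
  obtain ⟨L, hL⟩ := exists_lipschitz_superpose (d := d) hρ0 hρ2 hsum
  have hsumρ : Summable fun n => |a (n + 1)| * ρ ^ (n + 1) :=
    hsum.of_nonneg_of_le (fun n => by positivity) fun n => by gcongr
  have hpf {f : C(Torus d, ℂ)} (hf : ‖f‖ ≤ ρ) :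
      (fun x => powerFun a (f x)) = superpose a f :=
    funext fun x => (superpose_apply ha hsumρ hf x).symm
  have hun : ∀ᶠ z in 𝓝 0, ‖u z‖ < ρ :=
    (hua 0 h0).continuousAt.norm.eventually (gt_mem_nhds hρ1)
  have hvn : ∀ᶠ z in 𝓝 0, ‖v z‖ < ρ :=
    (hva 0 h0).continuousAt.norm.eventually (gt_mem_nhds (by simpa [huv] using hρ1))
  have hev := eventually_eq_zero_of_coeff_deriv_le (f := v - u) ((hva 0 h0).sub (hua 0 h0))
    (by simp [huv]) (M := fun k => ‖m k‖ * L) fun k => by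
      filter_upwards [self_mem_nhdsWithin, nhdsWithin_le_nhds (hS.mem_nhds h0),
        nhdsWithin_le_nhds hun, nhdsWithin_le_nhds hvn] with z hz hzS h1 h2
      have hzR : z ∈ R := hR ▸ ⟨hzS, hz⟩
      obtain ⟨w, hw, hwm⟩ := hu.equation z hzR
      obtain ⟨w', hw', hwm'⟩ := hv.equation z hzR
      have e1 : coeffCLM k w = m k * coeffCLM k (superpose a (u z)) := by
        have := hwm k
        rwa [hpf h1.le] at this
      have e2 : coeffCLM k w' = m k * coeffCLM k (superpose a (v z)) := by
        have := hwm' k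
        rwa [hpf h2.le] at this
      rw [(hw'.sub hw).deriv, map_sub, e1, e2, ← mul_sub, ← map_sub, norm_mul, mul_assoc]
      gcongr
      exact (norm_coeff_le _ k).trans (hL _ _ h2.le h1.le)
  have heq := (hva.sub hua).eqOn_zero_of_preconnected_of_eventuallyEq_zero hSc h0 hev
  intro z hz
  exact sub_eq_zero.1 (heq (hR ▸ hz : z ∈ S \ {0}).1)

end Uniqueness

/-! ### From the Picard limit to solutions -/

section Existence

variable {d : ℕ} {a : ℕ → ℝ}

lemma ofReal_le_majorantRadius {ρ : ℝ} (h0 : 0 ≤ ρ)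
    (hρ : Summable fun n => |a (n + 1)| * ρ ^ (n + 1)) : ENNReal.ofReal ρ ≤ majorantRadius a := by
  refine le_iSup₂_of_le (f := fun (s : ℝ≥0) (_ : s ∈ {s : ℝ≥0 | ∑' n : ℕ, ‖a n‖ₑ *
    (s : ℝ≥0∞) ^ n < ∞}) => (s : ℝ≥0∞)) ρ.toNNReal ?_ le_rfl
  have h1 : Summable fun n => |a n| * ρ ^ n := (summable_nat_add_iff 1).1 hρ
  have h2 := h1.tsum_ofReal_lt_top
  refine lt_of_le_of_lt (le_of_eq (tsum_congr fun n => ?_)) h2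
  rw [ENNReal.ofReal_mul (abs_nonneg _), ENNReal.ofReal_pow h0, ← Real.norm_eq_abs, ofReal_norm]
  rfl

/-- Mean-free functions in the exponentially weighted Wiener class take values strictly inside the
disc of convergence. -/
lemma enorm_fourierSum_lt_majorantRadius {ρ β : ℝ} (hβ : 0 < β) (h0 : 0 ≤ ρ)
    (hρ : Summable fun n => |a (n + 1)| * ρ ^ (n + 1)) (hR : 0 < majorantRadius a)
    {c : (Fin d → ℤ) → ℂ} (hc0 : c 0 = 0) {W : (Fin d → ℤ) → ℝ≥0∞}
    (hW : ∑' k, W k ≤ ENNReal.ofReal ρ) (hc : ∀ k, expWeight β k * ‖c k‖ₑ ≤ W k) :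
    ‖fourierSum c‖ₑ < majorantRadius a := by
  -- Every nonzero frequency has length at least `1`, so the weight gains `exp β > 1`; this makes
  -- the final inequality strict.
  have h1 : ENNReal.ofReal (Real.exp β) * ‖fourierSum c‖ₑ ≤ ENNReal.ofReal ρ := by
    refine (mul_le_mul' le_rfl enorm_fourierSum_le).trans (le_trans ?_ hW)
    rw [← ENNReal.tsum_mul_left]
    refine ENNReal.tsum_le_tsum fun k => ?_
    by_cases hk : k = 0
    · simp [hk, hc0]
    · refine le_trans (mul_le_mul' (ENNReal.ofReal_le_ofReal (Real.exp_le_exp.2 ?_)) le_rfl) (hc k)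
      exact le_mul_of_one_le_right hβ.le (one_le_freqNorm hk)
  rcases h0.eq_or_lt with rfl | hpos
  · rw [ENNReal.ofReal_zero, nonpos_iff_eq_zero, mul_eq_zero] at h1
    have h2 := h1.resolve_left (by simp [Real.exp_pos])
    rwa [h2]
  · refine lt_of_lt_of_le ?_ (ofReal_le_majorantRadius h0 hρ)
    rw [← ofReal_norm, ← ENNReal.ofReal_mul (Real.exp_nonneg _),
      ENNReal.ofReal_le_ofReal_iff h0] at h1
    rw [← ofReal_norm, ENNReal.ofReal_lt_ofReal_iff hpos]
    have h2 : 1 < Real.exp β := Real.one_lt_exp_iff.2 hβ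
    by_contra! hcon
    nlinarith

lemma enorm_apply_le (f : C(Torus d, ℂ)) (x : Torus d) : ‖f x‖ₑ ≤ ‖f‖ₑ := by
  rw [← ofReal_norm, ← ofReal_norm]
  exact ENNReal.ofReal_le_ofReal (f.norm_coe_le_norm x)

lemma fourierSum_coeff_ae_eq {u₀ : Torus d → ℂ} (hu : MemLp u₀ 2 volume)
    (hs : Summable fun k => ‖coeff u₀ k‖) :
    (fourierSum (coeff u₀) : Torus d → ℂ) =ᵐ[volume] u₀ := by
  have hcont (f : C(Torus d, ℂ)) : MemLp f 2 (volume : Measure (Torus d)) :=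
    f.continuous.memLp_of_hasCompactSupport (HasCompactSupport.of_compactSpace _)
  have h := ae_eq_zero_of_coeff_eq_zero ((hcont (fourierSum (coeff u₀))).sub hu) fun k => by
    have h1 := coeff_fourierSum hs k
    rw [coeffCLM_apply, coeff_eq, coeff_eq] at h1
    simp only [coeff_eq, Pi.sub_apply, sub_mul]
    rw [← sub_eq_zero, ← mul_sub] at h1
    rw [← h1]
    exact congrArg _ (integral_sub ((hcont _).integrable_mul (hcont (character (-k))))
      (hu.integrable_mul (hcont (character (-k)))))
  filter_upwards [h] with x hx
  exact sub_eq_zero.1 hx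

lemma tsum_le_Ftilde (r : ℝ) (hr : 0 ≤ r) (a : ℕ → ℝ) (s : ℝ≥0∞) :
    ∑' n : ℕ, ‖a (n + 1)‖ₑ * (wienerConst d r * s) ^ n ≤ Ftilde d r a s := by
  refine ENNReal.tsum_le_tsum fun n => ?_
  rw [mul_pow, ← mul_assoc]
  refine mul_le_mul' (mul_le_mul' (le_mul_of_one_le_right zero_le ?_) le_rfl) le_rfl
  rw [ENNReal.one_le_ofReal]
  exact Real.one_le_rpow (by simp) (by linarith)

lemma summable_of_Ftilde_ne_top {r : ℝ} (hr : 0 ≤ r) {s : ℝ≥0∞}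
    (hF : Ftilde d r a s ≠ ∞) :
    Summable fun n => |a (n + 1)| * (wienerConst d r * s).toReal ^ (n + 1) := by
  have h1 := ENNReal.summable_toReal (ne_top_of_le_ne_top hF (tsum_le_Ftilde r hr a s))
  refine (h1.mul_right (wienerConst d r * s).toReal).congr fun n => ?_
  simp only [ENNReal.toReal_mul, ENNReal.toReal_pow, toReal_enorm, Real.norm_eq_abs]
  ring

/-- Either the admissible ball reduces to `f = 0`, or every coefficient `a (n + 1)` vanishes. -/
lemma superpose_eq_zero_of_Ftilde_eq_zero {r : ℝ} (hr : 0 ≤ r) {s : ℝ≥0∞}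
    (hF : Ftilde d r a s = 0) {f : C(Torus d, ℂ)} (hf : ‖f‖ₑ ≤ wienerConst d r * s) :
    superpose a f = 0 := by
  have h1 : ∑' n : ℕ, ‖a (n + 1)‖ₑ * (wienerConst d r * s) ^ n = 0 :=
    nonpos_iff_eq_zero.1 (hF ▸ tsum_le_Ftilde r hr a s)
  rw [ENNReal.tsum_eq_zero] at h1
  by_cases hWs : wienerConst d r * s = 0
  · rw [hWs, nonpos_iff_eq_zero, enorm_eq_zero] at hf
    rw [hf, superpose_zero]
  · have ha (n : ℕ) : a (n + 1) = 0 := by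
      have := (mul_eq_zero.1 (h1 n)).resolve_right (pow_ne_zero _ hWs)
      simpa using this
    simp [superpose, ha]

variable {m : (Fin d → ℤ) → ℂ} {u₀ : Torus d → ℂ}

lemma PicardSetting.isSolution (ha : a 0 = 0) (hR : 0 < majorantRadius a)
    (hu : MemLp u₀ 2 volume) {b lam CT ρ : ℝ} {V : ℕ → (Fin d → ℤ) → ℝ≥0∞}
    {W : (Fin d → ℤ) → ℝ≥0∞} (h : PicardSetting m a (coeff u₀) b lam CT ρ V W) (hW0 : W 0 = 0)
    {R : Set ℂ} (hRb : R ⊆ Metric.ball 0 (b / lam)) :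
    IsSolution m a u₀ R fun z => fourierSum (h.picardLimit z) := by
  have hWtop : ∑' k, W k ≠ ∞ := ne_top_of_le_ne_top ENNReal.ofReal_ne_top h.tsum_le
  have h0 : (0 : ℂ) ∈ Metric.ball (0 : ℂ) (b / lam) :=
    Metric.mem_ball_self (div_pos h.b_pos h.lam_pos)
  have hs {z : ℂ} (hz : z ∈ Metric.ball (0 : ℂ) (b / lam)) :
      Summable fun k => ‖h.picardLimit z k‖ :=
    summable_of_expWeight_mul_le (h.exponent_pos hz).le hWtop (h.expWeight_mul_picardLimit_le hz)
  have hzero {z : ℂ} (hz : z ∈ Metric.ball (0 : ℂ) (b / lam)) : h.picardLimit z 0 = 0 := by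
    have := h.expWeight_mul_picardLimit_le hz 0
    simpa [hW0, expWeight_zero_right] using this
  have hdiff := h.differentiableOn_fourierSum_controlled h.controlled_picardLimit
  refine ⟨fun z hz => ?_, fun z hz x => ?_, fun z hz => ?_, ?_, ?_⟩
  · rw [← coeffCLM_apply, coeff_fourierSum (hs (hRb hz)), hzero (hRb hz)]
  · exact (enorm_apply_le _ x).trans_lt (enorm_fourierSum_lt_majorantRadius
      (h.exponent_pos (hRb hz)) h.rho_nonneg h.summable hR (hzero (hRb hz)) h.tsum_le
      (h.expWeight_mul_picardLimit_le (hRb hz)))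
  · have hz' := hRb hz
    have hd := (hdiff.differentiableAt (Metric.isOpen_ball.mem_nhds hz')).hasDerivAt
    refine ⟨_, hd, fun k => ?_⟩
    have e1 : (fun x => powerFun a (fourierSum (h.picardLimit z) x)) =
        superpose a (fourierSum (h.picardLimit z)) :=
      funext fun x => (superpose_apply ha h.summable
        (h.norm_fourierSum_le h.controlled_picardLimit hz') x).symm
    rw [e1, ← coeffCLM_apply, ← coeffCLM_apply]
    refine ((coeffCLM k).hasFDerivAt.comp_hasDerivAt z hd).unique
      ((h.hasDerivAt_picardLimit hz' k).congr_of_eventuallyEq ?_)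
    filter_upwards [Metric.isOpen_ball.mem_nhds hz'] with w hw
    exact coeff_fourierSum (hs hw) k
  · rw [h.picardLimit_zero]
    refine fourierSum_coeff_ae_eq hu ?_
    simpa only [h.picardLimit_zero] using hs h0
  · exact (hdiff.differentiableAt (Metric.isOpen_ball.mem_nhds h0)).continuousAt.continuousWithinAt

lemma isSolution_const (ha : a 0 = 0) {R : Set ℂ} {f : C(Torus d, ℂ)}
    (hf0 : coeffCLM 0 f = 0) (hfu : (f : Torus d → ℂ) =ᵐ[volume] u₀)
    (hfR : ‖f‖ₑ < majorantRadius a) (hF : superpose a f = 0) :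
    IsSolution m a u₀ R fun _ => f := by
  refine ⟨fun _ _ => hf0, fun _ _ x => (enorm_apply_le f x).trans_lt hfR,
    fun z _ => ⟨0, hasDerivAt_const z f, fun k => ?_⟩, hfu, continuousWithinAt_const⟩
  obtain ⟨s, hs, hsum⟩ := exists_summable_of_lt_majorantRadius (norm_nonneg f)
    (by rwa [ofReal_norm])
  have e1 : (fun x => powerFun a (f x)) = superpose a f :=
    funext fun x => (superpose_apply ha hsum hs.le x).symm
  rw [e1, hF, ← coeffCLM_apply, map_zero, mul_zero]

lemma gevreyHolomorphicOn_const {r β : ℝ} (hβ : 0 < β) {R : Set ℂ} {f : C(Torus d, ℂ)}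
    (hf : gevreyNorm r β f < ∞) : GevreyHolomorphicOn r R fun _ => f := by
  refine fun _ _ => ⟨β, hβ, Eventually.of_forall fun z => ⟨hf, ?_⟩⟩
  have h0 : gevreyNorm r β (0 : C(Torus d, ℂ)) = 0 := by
    have := gevreyNorm_le_of_coeff_le (r := r) (β := β) (f := 0) (W := 0) (κ := 0) (d := d)
      (by simp)
    simpa using this
  simp only [deriv_const, sub_self, smul_zero, h0]
  exact tendsto_const_nhds

lemma region_eq (r : ℝ) (C β₀ : ℝ) (s : ℝ≥0∞) : region d r a C β₀ s =
    {ζ : ℂ | ‖ζ‖ₑ < ENNReal.ofReal (C * β₀) / Ftilde d r a s} \ {0} := by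
  ext ζ
  simp [region, and_comm]

lemma isPreconnected_enorm_lt (x : ℝ≥0∞) : IsPreconnected {ζ : ℂ | ‖ζ‖ₑ < x} := by
  by_cases hx : x = ∞
  · subst hx
    simpa using isPreconnected_univ
  · have : {ζ : ℂ | ‖ζ‖ₑ < x} = Metric.ball 0 x.toReal := by
      ext ζ
      rw [mem_ofPred_eq, mem_ball_zero_iff, ← ofReal_norm, ENNReal.ofReal_lt_iff_lt_toReal
        (norm_nonneg _) hx]
    rw [this]
    exact (convex_ball 0 _).isPreconnected

end Existence

end GevreyAnalytic

end

/-! ### Assembly: choice of constants and the degenerate cases -/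

open GevreyAnalytic in
theorem theorem7p3 (d : ℕ) (hd : 1 ≤ d) (CT : ℝ) (hCT : 0 < CT) :
    ∃ C : ℝ, 0 < C ∧
      ∀ (r : ℝ), ((d : ℝ) + 1) / 2 < r →
      ∀ (a : ℕ → ℝ), a 0 = 0 → 0 < GevreyAnalytic.majorantRadius a →
      ∀ (m : (Fin d → ℤ) → ℂ), m 0 = 0 →
        (∀ k, k ≠ 0 → ‖m k‖ ≤ CT * GevreyAnalytic.freqNorm k) →
      ∀ (β₀ : ℝ), 0 < β₀ →
      ∀ (u₀ : GevreyAnalytic.Torus d → ℂ), MemLp u₀ 2 volume → GevreyAnalytic.coeff u₀ 0 = 0 →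
        GevreyAnalytic.gevreyNorm r β₀ u₀ < ∞ →
      ∃ u : ℂ → C(GevreyAnalytic.Torus d, ℂ),
        GevreyAnalytic.IsSolution m a u₀
          (GevreyAnalytic.region d r a C β₀ (GevreyAnalytic.gevreyNorm r β₀ u₀)) u ∧
        GevreyAnalytic.GevreyHolomorphicOn r
          (GevreyAnalytic.region d r a C β₀ (GevreyAnalytic.gevreyNorm r β₀ u₀)) u ∧
        ∀ v : ℂ → C(GevreyAnalytic.Torus d, ℂ),
          GevreyAnalytic.IsSolution m a u₀
            (GevreyAnalytic.region d r a C β₀ (GevreyAnalytic.gevreyNorm r β₀ u₀)) v →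
          EqOn v u (GevreyAnalytic.region d r a C β₀ (GevreyAnalytic.gevreyNorm r β₀ u₀)) := by
  -- With `b = β₀/2` and `lam = 2 CT F̃`, the radius `b/lam` is `β₀ / (4 CT F̃)`.
  refine ⟨1 / (4 * CT), by positivity, ?_⟩
  intro r hr a ha hRM m hm0 hm β₀ hβ₀ u₀ hu hu0 hfin
  have hr0 : 0 ≤ r := le_trans (by positivity) hr.le
  set s := gevreyNorm r β₀ u₀ with hs
  set R := region d r a (1 / (4 * CT)) β₀ s with hRdef
  set G : (Fin d → ℤ) → ℝ≥0∞ := fun k => expWeight β₀ k * ‖coeff u₀ k‖ₑ with hG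
  have hsG : s = l2 (sobolevWeight r * G) := gevreyNorm_eq r β₀ u₀
  have hG0 : G 0 = 0 := by simp [hG, hu0]
  have hWs : wienerConst d r * s ≠ ∞ := ENNReal.mul_ne_top (wienerConst_ne_top hr) hfin.ne
  set ρ := (wienerConst d r * s).toReal with hρ
  have hρeq : ENNReal.ofReal ρ = wienerConst d r * s := ENNReal.ofReal_toReal hWs
  have hρ0 : 0 ≤ ρ := ENNReal.toReal_nonneg
  have hsumG : ∑' k, G k ≤ ENNReal.ofReal ρ := by
    rw [hρeq, hsG]
    exact tsum_le_wienerConst_mul hG0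
  have hsummable : Summable fun k => ‖coeff u₀ k‖ :=
    summable_of_expWeight_mul_le hβ₀.le (ne_top_of_le_ne_top ENNReal.ofReal_ne_top hsumG)
      fun k => le_rfl
  have hae := fourierSum_coeff_ae_eq hu hsummable
  have hgev : gevreyNorm r β₀ (fourierSum (coeff u₀)) < ∞ := by
    refine lt_of_le_of_lt (gevreyNorm_le_of_coeff_le (κ := 1) (W := G) fun k => ?_)
      (by rwa [one_mul, ← hsG])
    rw [coeff_fourierSum hsummable, one_mul]
  -- On the empty region only the initial condition and continuity at `0` remain, so a constant map
  -- serves.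
  by_cases hFtop : Ftilde d r a s = ∞
  · have hempty : R = ∅ := by
      ext ζ
      simp [hRdef, region, hFtop]
    rw [hempty]
    refine ⟨fun _ => fourierSum (coeff u₀), ⟨by simp, by simp, by simp, hae,
      continuousWithinAt_const⟩, gevreyHolomorphicOn_const hβ₀ hgev, fun v _ => eqOn_empty _ _⟩
  have hsum := summable_of_Ftilde_ne_top hr0 hFtop
  have hu0R : ‖fourierSum (coeff u₀)‖ₑ < majorantRadius a :=
    enorm_fourierSum_lt_majorantRadius hβ₀ hρ0 hsum hRM hu0 hsumG fun k => le_rfl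
  suffices h : ∃ u : ℂ → C(Torus d, ℂ), IsSolution m a u₀ R u ∧ GevreyHolomorphicOn r R u by
    obtain ⟨u, hu1, hu2⟩ := h
    refine ⟨u, hu1, hu2, fun v hv => ?_⟩
    refine IsSolution.eqOn ha (isOpen_lt continuous_enorm continuous_const)
      (isPreconnected_enorm_lt _) ?_ (region_eq r _ β₀ s) hu1 hv ?_
    · simp only [mem_ofPred_eq, enorm_zero]
      exact ENNReal.div_pos (by simp; positivity) hFtop
    · have : u 0 = fourierSum (coeff u₀) := DFunLike.coe_injective
        ((Continuous.ae_eq_iff_eq volume (u 0).continuous (fourierSum _).continuous).1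
          (hu1.initial.trans hae.symm))
      rwa [this]
  -- Here `lam` would be zero and the region is the whole punctured plane; the nonlinearity vanishes
  -- at the datum, so the constant map solves the problem.
  by_cases hFzero : Ftilde d r a s = 0
  · refine ⟨fun _ => fourierSum (coeff u₀), isSolution_const ha ?_ hae hu0R
      (superpose_eq_zero_of_Ftilde_eq_zero hr0 hFzero ?_), gevreyHolomorphicOn_const hβ₀ hgev⟩
    · rw [coeff_fourierSum hsummable, hu0]
    · rw [← hρeq, ← ofReal_norm]
      exact ENNReal.ofReal_le_ofReal (norm_fourierSum_le hβ₀.le hρ0 hsumG fun k => le_rfl)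
  set F := (Ftilde d r a s).toReal with hF
  have hFpos : 0 < F := ENNReal.toReal_pos hFzero hFtop
  have hFeq : Ftilde d r a s = ENNReal.ofReal F := (ENNReal.ofReal_toReal hFtop).symm
  -- The choice `lam = 2 CT F` makes `ε = 1/(2F)`, so the smallness condition holds with equality.
  have hε : 2 * (ENNReal.ofReal (CT / (2 * CT * F)) * Ftilde d r a (l2 (sobolevWeight r * G))) ≤
      1 := by
    rw [← hsG, hFeq, ← ENNReal.ofReal_mul (by positivity), ← ENNReal.ofReal_ofNat 2,
      ← ENNReal.ofReal_mul (by positivity), ENNReal.ofReal_le_one]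
    apply le_of_eq
    field_simp
  have h2b : (2 : ℝ) * (β₀ / 2) = β₀ := by ring
  set W := majorantLimit (β₀ / 2) (ENNReal.ofReal (CT / (2 * CT * F))) (fun n => ‖a n‖ₑ) G with hW
  have hWl2 : l2 (sobolevWeight r * W) ≤ s :=
    hsG ▸ l2_majorantLimit_le hr0 (by positivity) hG0 hε
  have hW0 : W 0 = 0 := majorantLimit_zero hG0
  have hset : PicardSetting m a (coeff u₀) (β₀ / 2) (2 * CT * F) CT ρ
      (majorantIter (β₀ / 2) (ENNReal.ofReal (CT / (2 * CT * F))) (fun n => ‖a n‖ₑ) G) W := by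
    refine ⟨by positivity, by positivity, hCT.le, hm0, hm, hρ0, hsum, by rw [h2b], by rw [h2b], ?_⟩
    rw [hρeq]
    exact (tsum_le_wienerConst_mul hW0).trans (mul_le_mul' le_rfl hWl2)
  have hRball : R ⊆ Metric.ball 0 (β₀ / 2 / (2 * CT * F)) := by
    intro ζ hζ
    have h1 := hζ.2
    rw [hFeq, ← ENNReal.ofReal_div_of_pos hFpos, ← ofReal_norm,
      ENNReal.ofReal_lt_ofReal_iff_of_nonneg (norm_nonneg _)] at h1
    rw [mem_ball_zero_iff]
    refine h1.trans_eq ?_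
    field_simp
    norm_num
  have hWtop : ∑' k, W k ≠ ∞ := ne_top_of_le_ne_top ENNReal.ofReal_ne_top hset.tsum_le
  refine ⟨_, hset.isSolution ha hRM hu hW0 hRball, gevreyHolomorphicOn_of_controlled hset.lam_pos
    hWtop (ne_top_of_le_ne_top hfin.ne hWl2) hset.controlled_picardLimit (fun z hz k => ?_)
    (hset.differentiableOn_fourierSum_controlled hset.controlled_picardLimit) hRball⟩
  exact coeff_fourierSum (summable_of_expWeight_mul_le (hset.exponent_pos hz).le hWtop
    (hset.expWeight_mul_picardLimit_le hz)) k
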